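/- Let $Y$ be a nonempty closed oriented Riemannian manifold of dimension $n\ge 2$, let $G$ be a compact Lie group of dimension $d>0$ with Lie algebra $\mathfrak g$, and let $P\to Y$ be a principal $G$-bundle with adjoint bundle $\operatorname{ad}(P)$ and space of connections $\mathcal A(P)$. Let $I\subseteq\mathbb R$ be a nonempty open interval and $$(A,\omega,\Psi)\in C^\infty\bigl(I,\ \mathcal A(P)\times\Omega^{n-2}(Y,\operatorname{ad}(P))\times\Omega^0(Y,\operatorname{ad}(P))\bigr).$$ Let $\nabla_s=\partial_s+[\Psi\wedge\,\cdot\,]$, let $d_A$ be the exterior covariant derivative and let $d_A^*=-\ast d_A\ast$ be its formal adjoint on $1$-forms. Consider the first order linear differential operator $\nabla_s+B_{(A,\omega,\Psi)}$ acting on triples $(\alpha,v,\psi)\in C^\infty(I,\Omega^1(Y,\operatorname{ad}(P))\times\Omega^{n-2}(Y,\operatorname{ad}(P))\times\Omega^0(Y,\operatorname{ad}(P)))$ by $$(\nabla_s+B_{(A,\omega,\Psi)})\begin{pmatrix}\alpha\\ v\\ \psi\end{pmatrix}=\begin{pmatrix}\nabla_s\alpha+\ast[\omega\wedge\alpha]+(-1)^{n+1}\ast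 d_Av-d_A\psi\\ \nabla_sv+\ast d_A\alpha-v-[\omega\wedge\psi]\\ \nabla_s\psi-d_A^*\alpha+\ast[\omega\wedge\ast v]\end{pmatrix}.$$ This is the linearization, at $(A,\omega,\Psi)$, of the elliptic Yang–Mills flow $\partial_sA-d_A\Psi+(-1)^{n+1}\ast d_A\omega=0$, $\partial_s\omega+[\Psi,\omega]-\omega+\ast F_A=0$, augmented by a gauge-fixing component. Then this operator is elliptic on $I\times Y$ (that is, its principal symbol at every nonzero real covector of $I\times Y$ is an isomorphism) if and only if $n=2$. -/

import Mathlib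

open scoped Manifold ContDiff Bundle Nat
open Bundle Module

noncomputable section

/-! ### Instances on tangent spaces and on the Lie algebra of a Lie group -/

section Instances

/-- A `C^∞` real Lie group has the regularity that Mathlib asks for in order to equip its tangent
space at the identity with the Lie algebra structure. -/
instance lieGroupMinSmoothness {d : ℕ} {G : Type*} [TopologicalSpace G]
    [ChartedSpace (EuclideanSpace ℝ (Fin d)) G] [Group G] [LieGroup (𝓡 d) ∞ G] :
    LieGroup (𝓡 d) (minSmoothness ℝ 3) G :=
  LieGroup.of_le (n := ∞) (by
    rw [minSmoothness_of_isRCLikeNormedField]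
    exact WithTop.coe_le_coe.2 le_top)

variable {d : ℕ} {G : Type*} [TopologicalSpace G]
    [ChartedSpace (EuclideanSpace ℝ (Fin d)) G] [Group G]

/-- A norm on the finite-dimensional Lie algebra of `G` (the one of the model space). It is used
only through its topology, which is the canonical one. -/
instance lieAlgebraNormedAddCommGroup : NormedAddCommGroup (GroupLieAlgebra (𝓡 d) G) :=
  inferInstanceAs (NormedAddCommGroup (EuclideanSpace ℝ (Fin d)))

instance lieAlgebraNormedSpace : NormedSpace ℝ (GroupLieAlgebra (𝓡 d) G) :=
  inferInstanceAs (NormedSpace ℝ (EuclideanSpace ℝ (Fin d)))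

instance tangentSpaceFiniteDimensional {n : ℕ} {Y : Type*} [TopologicalSpace Y]
    [ChartedSpace (EuclideanSpace ℝ (Fin n)) Y] (y : Y) :
    FiniteDimensional ℝ (TangentSpace (𝓡 n) y) :=
  inferInstanceAs (FiniteDimensional ℝ (EuclideanSpace ℝ (Fin n)))

instance tangentSpaceFinrank {n : ℕ} {Y : Type*} [TopologicalSpace Y]
    [ChartedSpace (EuclideanSpace ℝ (Fin n)) Y] (y : Y) :
    Fact (finrank ℝ (TangentSpace (𝓡 n) y) = n) :=
  ⟨(finrank_euclideanSpace_fin : finrank ℝ (EuclideanSpace ℝ (Fin n)) = n)⟩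

end Instances

/-! ### The Hodge star on an oriented Euclidean vector space -/

section Hodge

variable {V : Type*} [NormedAddCommGroup V] [InnerProductSpace ℝ V]
  {W : Type*} [NormedAddCommGroup W] [NormedSpace ℝ W]
  {n k l : ℕ}

/-- The Euclidean volume form of an oriented Euclidean space of dimension `n`. -/
def volForm [Fact (finrank ℝ V = n)] (o : Orientation ℝ V (Fin n)) : V [⋀^Fin n]→L[ℝ] ℝ :=
  o.volumeForm.mkContinuous 1 (fun v => by
    simpa using o.abs_volumeForm_apply_le v)

theorem append_update {α : Type*} (u : Fin k → α) (v : Fin l → α) (i : Fin l) (x : α) :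
    Fin.append u (Function.update v i x) =
      Function.update (Fin.append u v) (Fin.natAdd k i) x := by
  funext j
  refine Fin.addCases (fun a => ?_) (fun a => ?_) j
  · rw [Function.update_of_ne (by
      intro h
      have := congrArg Fin.val h
      simp at this
      omega)]
    simp
  · by_cases h : a = i
    · subst h; simp
    · rw [Function.update_of_ne (by simpa using h)]
      simp [h]

/-- The `l`-form `μ(u₁, …, u_k, · , …, ·)`, for an `n`-form `μ` with `n = k + l`. -/
def insertLeft (h : k + l = n) (μ : V [⋀^Fin n]→L[ℝ] ℝ) (u : Fin k → V) :
    V [⋀^Fin l]→L[ℝ] ℝ where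
  toFun v := μ (fun i => Fin.append u v (Fin.cast h.symm i))
  map_update_add' := by
    intro inst v i x y
    obtain rfl : inst = instDecidableEqFin _ := Subsingleton.elim _ _
    subst h
    have key : ∀ z, (fun j => Fin.append u (Function.update v i z) (Fin.cast rfl j)) =
        Function.update (Fin.append u v) (Fin.natAdd k i) z := append_update u v i
    simp only [key]
    exact μ.map_update_add _ _ _ _
  map_update_smul' := by
    intro inst v i c x
    obtain rfl : inst = instDecidableEqFin _ := Subsingleton.elim _ _
    subst h
    have key : ∀ z, (fun j => Fin.append u (Function.update v i z) (Fin.cast rfl j)) =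
        Function.update (Fin.append u v) (Fin.natAdd k i) z := append_update u v i
    simp only [key]
    exact μ.map_update_smul _ _ _ _
  map_eq_zero_of_eq' := by
    intro v i j hv hij
    subst h
    refine μ.map_eq_zero_of_eq (i := Fin.natAdd k i) (j := Fin.natAdd k j) _ ?_ ?_
    · simpa using hv
    · simpa using hij
  cont := by
    subst h
    refine μ.cont.comp (continuous_pi fun i => ?_)
    refine Fin.addCases (fun j => ?_) (fun j => ?_) i
    · simpa using continuous_const
    · simpa using continuous_apply j

/-- The Hodge star `Λ^k V^* ⊗ W → Λ^l V^* ⊗ W`, `k + l = n`, of an oriented Euclidean space of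
dimension `n`:
`(⋆α)(v₁,…,v_l) = (1/k!) ∑ α(e_{i₁},…,e_{i_k}) vol(e_{i₁},…,e_{i_k},v₁,…,v_l)`, the sum being over
all `i₁,…,i_k` for an orthonormal basis `e` (the result does not depend on the basis). Thus
`e^I ∧ ⋆e^I = vol`. -/
def hodgeStar [Fact (finrank ℝ V = n)] [FiniteDimensional ℝ V] (o : Orientation ℝ V (Fin n))
    (h : k + l = n) (α : V [⋀^Fin k]→L[ℝ] W) : V [⋀^Fin l]→L[ℝ] W :=
  (k ! : ℝ)⁻¹ • ∑ f : Fin k → Fin (finrank ℝ V),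
    (insertLeft h (volForm o) (fun i => stdOrthonormalBasis ℝ V (f i))).smulRight
      (α (fun i => stdOrthonormalBasis ℝ V (f i)))

end Hodge

/-! ### The wedge bracket of Lie algebra valued forms, and the adjoint representation -/

section LieAlgebraForms

variable {d : ℕ} {G : Type*} [TopologicalSpace G]
    [ChartedSpace (EuclideanSpace ℝ (Fin d)) G] [Group G] [LieGroup (𝓡 d) ∞ G]
  {V : Type*} [AddCommGroup V] [Module ℝ V] [TopologicalSpace V]
  {k l m : ℕ}

/-- The adjoint action of `h : G` on the Lie algebra: the derivative at `1` of `x ↦ h x h⁻¹`. -/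
def Ad (h : G) : GroupLieAlgebra (𝓡 d) G →L[ℝ] GroupLieAlgebra (𝓡 d) G :=
  mfderiv (𝓡 d) (𝓡 d) (fun x : G => h * x * h⁻¹) 1

theorem continuous_lieBracket :
    Continuous (fun q : GroupLieAlgebra (𝓡 d) G × GroupLieAlgebra (𝓡 d) G => ⁅q.1, q.2⁆) := by
  have : FiniteDimensional ℝ (GroupLieAlgebra (𝓡 d) G) := inferInstance
  let B : GroupLieAlgebra (𝓡 d) G →ₗ[ℝ] GroupLieAlgebra (𝓡 d) G →ₗ[ℝ] GroupLieAlgebra (𝓡 d) G :=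
    LinearMap.mk₂ ℝ (fun x y => ⁅x, y⁆) (fun _ _ _ => add_lie _ _ _) (fun _ _ _ => smul_lie _ _ _)
      (fun _ _ _ => lie_add _ _ _) (fun _ _ _ => lie_smul _ _ _)
  exact (LinearMap.toContinuousBilinearMap B).continuous₂

section Update

variable {α : Type*} (v : Fin (k + l) → α) (x : α)

theorem update_castAdd_castAdd (j : Fin k) :
    (fun i => Function.update v (Fin.castAdd l j) x (Fin.castAdd l i)) =
      Function.update (fun i => v (Fin.castAdd l i)) j x := by
  funext i
  by_cases h : i = j
  · subst h; simp
  · rw [Function.update_of_ne (by simpa using h), Function.update_of_ne h]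

theorem update_natAdd_natAdd (j : Fin l) :
    (fun i => Function.update v (Fin.natAdd k j) x (Fin.natAdd k i)) =
      Function.update (fun i => v (Fin.natAdd k i)) j x := by
  funext i
  by_cases h : i = j
  · subst h; simp
  · rw [Function.update_of_ne (by simpa using h), Function.update_of_ne h]

theorem update_castAdd_natAdd (j : Fin k) :
    (fun i => Function.update v (Fin.castAdd l j) x (Fin.natAdd k i)) =
      fun i => v (Fin.natAdd k i) := by
  funext i
  rw [Function.update_of_ne (by
    intro h
    have := congrArg Fin.val h
    simp at this
    omega)]

theorem update_natAdd_castAdd (j : Fin l) :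
    (fun i => Function.update v (Fin.natAdd k j) x (Fin.castAdd l i)) =
      fun i => v (Fin.castAdd l i) := by
  funext i
  rw [Function.update_of_ne (by
    intro h
    have := congrArg Fin.val h
    simp at this
    omega)]

end Update

/-- The multilinear map `v ↦ [a(v₁,…,v_k), b(v_{k+1},…,v_{k+l})]`. -/
def bracketMul (a : V [⋀^Fin k]→L[ℝ] GroupLieAlgebra (𝓡 d) G)
    (b : V [⋀^Fin l]→L[ℝ] GroupLieAlgebra (𝓡 d) G) :
    ContinuousMultilinearMap ℝ (fun _ : Fin (k + l) => V) (GroupLieAlgebra (𝓡 d) G) where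
  toFun v := ⁅a (fun i => v (Fin.castAdd l i)), b (fun i => v (Fin.natAdd k i))⁆
  map_update_add' := by
    intro inst v i x y
    obtain rfl : inst = instDecidableEqFin _ := Subsingleton.elim _ _
    refine Fin.addCases (fun j => ?_) (fun j => ?_) i
    · simp only [update_castAdd_castAdd, update_castAdd_natAdd, a.map_update_add, add_lie]
    · simp only [update_natAdd_castAdd, update_natAdd_natAdd, b.map_update_add, lie_add]
  map_update_smul' := by
    intro inst v i c x
    obtain rfl : inst = instDecidableEqFin _ := Subsingleton.elim _ _
    refine Fin.addCases (fun j => ?_) (fun j => ?_) i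
    · simp only [update_castAdd_castAdd, update_castAdd_natAdd, a.map_update_smul, smul_lie]
    · simp only [update_natAdd_castAdd, update_natAdd_natAdd, b.map_update_smul, lie_smul]
  cont := by
    refine continuous_lieBracket.comp (Continuous.prodMk
      (a.cont.comp (continuous_pi fun i => continuous_apply _))
      (b.cont.comp (continuous_pi fun i => continuous_apply _)))

/-- `[a ∧ b]` for Lie algebra valued alternating forms `a`, `b` of degrees `k`, `l`:
`[a ∧ b](v₁,…,v_{k+l}) = (1/(k! l!)) ∑_σ sgn σ [a(v_{σ1},…,v_{σk}), b(v_{σ(k+1)},…,v_{σ(k+l)})]`. -/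
def wedgeBracket (h : k + l = m) (a : V [⋀^Fin k]→L[ℝ] GroupLieAlgebra (𝓡 d) G)
    (b : V [⋀^Fin l]→L[ℝ] GroupLieAlgebra (𝓡 d) G) :
    V [⋀^Fin m]→L[ℝ] GroupLieAlgebra (𝓡 d) G :=
  ((k ! * l ! : ℕ) : ℝ)⁻¹ • ((bracketMul a b).domDomCongr (finCongr h)).alternatization

end LieAlgebraForms

/-! ### Differential forms on a manifold -/

section Forms

/-- Not necessarily continuous `F`-valued differential forms of degree `k` on an `m`-manifold. -/
abbrev MForm (m : ℕ) (M : Type*) [TopologicalSpace M] [ChartedSpace (EuclideanSpace ℝ (Fin m)) M]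
    (F : Type*) [NormedAddCommGroup F] [NormedSpace ℝ F] (k : ℕ) :=
  ∀ x : M, TangentSpace (𝓡 m) x [⋀^Fin k]→L[ℝ] F

variable {m k : ℕ} {M : Type*} [TopologicalSpace M] [ChartedSpace (EuclideanSpace ℝ (Fin m)) M]
  {F : Type*} [NormedAddCommGroup F] [NormedSpace ℝ F]

/-- The expression of a form in the chart around `x₀`, i.e. its pull-back under the inverse of
the chart. Only its values on the target of the chart are meaningful. -/
def chartForm (α : MForm m M F k) (x₀ : M) (u : EuclideanSpace ℝ (Fin m)) :
    EuclideanSpace ℝ (Fin m) [⋀^Fin k]→L[ℝ] F :=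
  (α ((extChartAt (𝓡 m) x₀).symm u)).compContinuousLinearMap
    ((mfderiv (𝓡 m) (𝓡 m) (extChartAt (𝓡 m) x₀).symm u).comp
      (NormedSpace.fromTangentSpace (𝕜 := ℝ) u).symm.toContinuousLinearMap)

/-- A family of forms on `M`, parametrized by `s ∈ I ⊆ ℝ`, is smooth jointly in `(s, x)`: all its
chart expressions are. -/
def SmoothFormsOn (I : Set ℝ) (α : ℝ → MForm m M F k) : Prop :=
  ∀ x₀ : M, ContDiffOn ℝ ∞
    (fun q : ℝ × EuclideanSpace ℝ (Fin m) => chartForm (α q.1) x₀ q.2)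
    (I ×ˢ (extChartAt (𝓡 m) x₀).target)

/-- A form is smooth if its chart expressions are. -/
def SmoothForm (α : MForm m M F k) : Prop :=
  ∀ x₀ : M, ContDiffOn ℝ ∞ (chartForm α x₀) (extChartAt (𝓡 m) x₀).target

/-- The exterior derivative of a form on a manifold, computed at `x` in the chart around `x`. -/
def mExtDeriv (α : MForm m M F k) : MForm m M F (k + 1) := fun x =>
  (extDeriv (chartForm α x) (extChartAt (𝓡 m) x x)).compContinuousLinearMap
    ((NormedSpace.fromTangentSpace (𝕜 := ℝ) (extChartAt (𝓡 m) x x)).toContinuousLinearMap.comp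
      (mfderiv (𝓡 m) (𝓡 m) (extChartAt (𝓡 m) x) x))

/-- An orientation of a Riemannian manifold: a choice of an orientation of every tangent space
which is locally constant, i.e. for which the Riemannian volume form is smooth. -/
def IsManifoldOrientation [RiemannianBundle (fun y : M => TangentSpace (𝓡 m) y)]
    (o : ∀ y : M, Orientation ℝ (TangentSpace (𝓡 m) y) (Fin m)) : Prop :=
  SmoothForm (F := ℝ) (k := m) (fun y : M => volForm (o y))

end Forms

/-! ### Principal bundles, connections, and forms with values in the adjoint bundle -/

section Bundles

variable {n d : ℕ}
  {Y : Type*} [TopologicalSpace Y] [ChartedSpace (EuclideanSpace ℝ (Fin n)) Y]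
  {G : Type*} [TopologicalSpace G] [ChartedSpace (EuclideanSpace ℝ (Fin d)) G] [Group G]
  {P : Type*} [TopologicalSpace P] [ChartedSpace (EuclideanSpace ℝ (Fin (n + d))) P]
  [MulAction Gᵐᵒᵖ P]

/-- `pr : P → Y` is a smooth principal `G`-bundle; the right action `(p, g) ↦ p · g` of `G` on `P`
is written as a left action of the opposite group. -/
structure IsPrincipalBundle (n d : ℕ) {Y : Type*} [TopologicalSpace Y]
    [ChartedSpace (EuclideanSpace ℝ (Fin n)) Y] (G : Type*) [TopologicalSpace G]
    [ChartedSpace (EuclideanSpace ℝ (Fin d)) G] [Group G] {P : Type*} [TopologicalSpace P]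
    [ChartedSpace (EuclideanSpace ℝ (Fin (n + d))) P] [MulAction Gᵐᵒᵖ P] (pr : P → Y) :
    Prop where
  contMDiff_act : ContMDiff ((𝓡 (n + d)).prod (𝓡 d)) (𝓡 (n + d)) ∞
    (fun q : P × G => MulOpposite.op q.2 • q.1)
  contMDiff_proj : ContMDiff (𝓡 (n + d)) (𝓡 n) ∞ pr
  proj_act : ∀ (p : P) (g : G), pr (MulOpposite.op g • p) = pr p
  /-- Every point of the base has an open neighbourhood `U` with a diffeomorphism
  `pr⁻¹(U) ≅ U × G` over `U` that is equivariant for the right actions. -/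
  locally_trivial : ∀ y : Y, ∃ (U : Set Y)
    (Φ : PartialDiffeomorph (𝓡 (n + d)) ((𝓡 n).prod (𝓡 d)) P (Y × G) ∞),
    IsOpen U ∧ y ∈ U ∧ Φ.source = pr ⁻¹' U ∧ Φ.target = U ×ˢ Set.univ ∧
    ∀ p ∈ Φ.source, (Φ p).1 = pr p ∧
      ∀ g : G, Φ (MulOpposite.op g • p) = ((Φ p).1, (Φ p).2 * g)

/-- Principal connections, given by their connection `1`-form `A : TP → 𝔤`: it sends fundamental
vector fields to their generators and is equivariant, `R_g^* A = Ad(g⁻¹) A`. (Smoothness is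
required separately.) -/
structure IsConnectionForm
    (A : ∀ p : P, TangentSpace (𝓡 (n + d)) p →L[ℝ] GroupLieAlgebra (𝓡 d) G) : Prop where
  fundamental : ∀ (p : P) (X : GroupLieAlgebra (𝓡 d) G),
    A (MulOpposite.op (1 : G) • p)
      (mfderiv (𝓡 d) (𝓡 (n + d)) (fun g : G => MulOpposite.op g • p) 1 X) = X
  equivariant : ∀ (p : P) (g : G) (w : TangentSpace (𝓡 (n + d)) p),
    A (MulOpposite.op g • p)
      (mfderiv (𝓡 (n + d)) (𝓡 (n + d)) (fun q : P => MulOpposite.op g • q) p w) =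
      Ad g⁻¹ (A p w)

/-- A path `I → 𝒜(P)` of smooth connections, smooth jointly in `s` and the point of `P`. -/
structure IsSmoothConnectionPath (I : Set ℝ)
    (A : ℝ → ∀ p : P, TangentSpace (𝓡 (n + d)) p →L[ℝ] GroupLieAlgebra (𝓡 d) G) : Prop where
  isConnection : ∀ s ∈ I, IsConnectionForm (A s)
  smooth : SmoothFormsOn (m := n + d) (k := 1) I (fun s p =>
    ContinuousAlternatingMap.ofSubsingleton ℝ (TangentSpace (𝓡 (n + d)) p)
      (GroupLieAlgebra (𝓡 d) G) (0 : Fin 1) (A s p))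

/-- The alternating `k`-forms on `T_{pr(p)}Y` with values in `𝔤`. The point `p` of the fibre `P_y`
identifies `𝔤` with the fibre of `ad(P)` over `y = pr(p)`, and hence this space with the fibre over
`y` of `Λ^k T^*Y ⊗ ad(P)`. -/
abbrev AdFibre (n d : ℕ) {Y : Type*} [TopologicalSpace Y]
    [ChartedSpace (EuclideanSpace ℝ (Fin n)) Y] {P : Type*} (G : Type*) [TopologicalSpace G] [ChartedSpace (EuclideanSpace ℝ (Fin d)) G]
    [Group G] (pr : P → Y) (k : ℕ) (p : P) :=
  TangentSpace (𝓡 n) (pr p) [⋀^Fin k]→L[ℝ] GroupLieAlgebra (𝓡 d) G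

/-- A form of degree `k` on `Y` with values in `ad(P) = P ×_G 𝔤`, given as a function on `P`; see
`IsAdForm` for the equivariance. -/
abbrev AdForm (n d : ℕ) {Y : Type*} [TopologicalSpace Y]
    [ChartedSpace (EuclideanSpace ℝ (Fin n)) Y] {P : Type*} (G : Type*) [TopologicalSpace G] [ChartedSpace (EuclideanSpace ℝ (Fin d)) G]
    [Group G] (pr : P → Y) (k : ℕ) :=
  ∀ p : P, AdFibre n d G pr k p

/-- The horizontal `𝔤`-valued form on `P` corresponding to an `ad(P)`-valued form on `Y`. -/
def pullbackForm (pr : P → Y) {k : ℕ} (α : AdForm n d G pr k) :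
    MForm (n + d) P (GroupLieAlgebra (𝓡 d) G) k :=
  fun p => (α p).compContinuousLinearMap (mfderiv (𝓡 (n + d)) (𝓡 n) pr p)

/-- Equivariance: `R_g^* α = Ad(g⁻¹) α` for the corresponding form on `P`. -/
def IsAdForm (pr : P → Y) {k : ℕ} (α : AdForm n d G pr k) : Prop :=
  ∀ (p : P) (g : G) (w : Fin k → TangentSpace (𝓡 (n + d)) p),
    pullbackForm pr α (MulOpposite.op g • p)
      (fun i => mfderiv (𝓡 (n + d)) (𝓡 (n + d)) (fun q : P => MulOpposite.op g • q) p (w i)) =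
      Ad g⁻¹ (pullbackForm pr α p w)

/-- A path `I → Ω^k(Y, ad(P))`, smooth jointly in `s` and the point. -/
structure IsSmoothAdPath (pr : P → Y) (I : Set ℝ) {k : ℕ} (α : ℝ → AdForm n d G pr k) : Prop where
  isAdForm : ∀ s ∈ I, IsAdForm pr (α s)
  smooth : SmoothFormsOn I (fun s => pullbackForm pr (α s))

/-- The horizontal lift `T_{pr(p)}Y → T_pP` of a connection: the inverse of
`(dpr, A) : T_pP ≅ T_{pr(p)}Y × 𝔤`, restricted to `T_{pr(p)}Y × 0`. -/
def horizontalLift (pr : P → Y)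
    (A : ∀ p : P, TangentSpace (𝓡 (n + d)) p →L[ℝ] GroupLieAlgebra (𝓡 d) G) (p : P) :
    TangentSpace (𝓡 n) (pr p) →L[ℝ] TangentSpace (𝓡 (n + d)) p :=
  ((mfderiv (𝓡 (n + d)) (𝓡 n) pr p).prod (A p)).inverse.comp
    (ContinuousLinearMap.inl ℝ (TangentSpace (𝓡 n) (pr p)) (GroupLieAlgebra (𝓡 d) G))

/-- The exterior covariant derivative `d_A`: the exterior derivative of the corresponding form on
`P`, evaluated on horizontal lifts. -/
def covExtDeriv (pr : P → Y)
    (A : ∀ p : P, TangentSpace (𝓡 (n + d)) p →L[ℝ] GroupLieAlgebra (𝓡 d) G)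
    {k : ℕ} (α : AdForm n d G pr k) : AdForm n d G pr (k + 1) :=
  fun p => (mExtDeriv (pullbackForm pr α) p).compContinuousLinearMap (horizontalLift pr A p)

end Bundles

/-! ### The linearized operator and its ellipticity -/

section Operator

variable {n d : ℕ}
  {Y : Type*} [TopologicalSpace Y] [ChartedSpace (EuclideanSpace ℝ (Fin n)) Y]
  {G : Type*} [TopologicalSpace G] [ChartedSpace (EuclideanSpace ℝ (Fin d)) G] [Group G]
  {P : Type*} [TopologicalSpace P] [ChartedSpace (EuclideanSpace ℝ (Fin (n + d))) P]
  [MulAction Gᵐᵒᵖ P]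

/-- The fibre of `(T^*Y ⊕ Λ^{n-2} T^*Y ⊕ Λ^0 T^*Y) ⊗ ad(P)` over `pr(p)`, seen from `p`. -/
abbrev TripleFibre (n d : ℕ) {Y : Type*} [TopologicalSpace Y]
    [ChartedSpace (EuclideanSpace ℝ (Fin n)) Y] {P : Type*} (G : Type*) [TopologicalSpace G] [ChartedSpace (EuclideanSpace ℝ (Fin d)) G]
    [Group G] (pr : P → Y) (p : P) :=
  AdFibre n d G pr 1 p × AdFibre n d G pr (n - 2) p × AdFibre n d G pr 0 p

/-- Time-dependent triples `(α, v, ψ)`. -/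
abbrev TripleField (n d : ℕ) {Y : Type*} [TopologicalSpace Y]
    [ChartedSpace (EuclideanSpace ℝ (Fin n)) Y] {P : Type*} (G : Type*) [TopologicalSpace G] [ChartedSpace (EuclideanSpace ℝ (Fin d)) G]
    [Group G] (pr : P → Y) :=
  ℝ → ∀ p : P, TripleFibre n d G pr p

/-- `(α, v, ψ) ∈ C^∞(I, Ω^1(Y, ad P) × Ω^{n-2}(Y, ad P) × Ω^0(Y, ad P))`: the smooth sections over
`I × Y` of the bundle on which the operator acts. -/
structure IsSmoothTriple (pr : P → Y) (I : Set ℝ) (u : TripleField n d G pr) : Prop where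
  fst : IsSmoothAdPath pr I (fun s p => (u s p).1)
  snd : IsSmoothAdPath pr I (fun s p => (u s p).2.1)
  thd : IsSmoothAdPath pr I (fun s p => (u s p).2.2)

/-- An operator `D` of first order on sections over `I × Y` is elliptic if its principal symbol at
every nonzero real covector is a linear isomorphism. The symbol at the covector `df` at
`(s, y)`, where `f` is a function vanishing at `(s, y)`, is the map `u(s, y) ↦ D(f u)(s, y)`;
every covector is such a `df`. -/
def IsElliptic (pr : P → Y) (I : Set ℝ) (D : TripleField n d G pr → TripleField n d G pr) : Prop :=
  ∀ s ∈ I, ∀ p : P, ∀ f : ℝ × Y → ℝ,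
    ContMDiff ((𝓘(ℝ, ℝ)).prod (𝓡 n)) 𝓘(ℝ, ℝ) ∞ f → f (s, pr p) = 0 →
    mfderiv ((𝓘(ℝ, ℝ)).prod (𝓡 n)) 𝓘(ℝ, ℝ) f (s, pr p) ≠ 0 →
    ∃ σ : TripleFibre n d G pr p ≃ₗ[ℝ] TripleFibre n d G pr p,
      ∀ u : TripleField n d G pr, IsSmoothTriple pr I u →
        D (fun t q => f (t, pr q) • u t q) s p = σ (u s p)

variable [LieGroup (𝓡 d) ∞ G]

/-- `∇_s α = ∂_s α + [Ψ ∧ α]`. -/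
def nablaS (pr : P → Y) (Ψ : ℝ → AdForm n d G pr 0) {k : ℕ} (α : ℝ → AdForm n d G pr k) :
    ℝ → AdForm n d G pr k :=
  fun s p => deriv (fun t => α t p) s + wedgeBracket (Nat.zero_add k) (Ψ s p) (α s p)

variable [RiemannianBundle (fun y : Y => TangentSpace (𝓡 n) y)]

/-- The Hodge star on `ad(P)`-valued forms on `Y`. -/
def adStar (pr : P → Y) (o : ∀ y : Y, Orientation ℝ (TangentSpace (𝓡 n) y) (Fin n))
    {k l : ℕ} (h : k + l = n) (α : AdForm n d G pr k) : AdForm n d G pr l :=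
  fun p => hodgeStar (o (pr p)) h (α p)

/-- The formal adjoint `d_A^* = - ⋆ d_A ⋆` of `d_A` on `1`-forms. -/
def covCoderiv (hn : 2 ≤ n) (pr : P → Y)
    (o : ∀ y : Y, Orientation ℝ (TangentSpace (𝓡 n) y) (Fin n))
    (A : ∀ p : P, TangentSpace (𝓡 (n + d)) p →L[ℝ] GroupLieAlgebra (𝓡 d) G)
    (α : AdForm n d G pr 1) : AdForm n d G pr 0 :=
  -adStar pr o (show n - 1 + 1 + 0 = n by omega)
    (covExtDeriv pr A (adStar pr o (show 1 + (n - 1) = n by omega) α))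

/-- The operator `∇_s + B_{(A,ω,Ψ)}`, the linearization of
`(A, ω, Ψ) ↦ (∂_s A - d_A Ψ + (-1)^{n+1} ⋆ d_A ω, ∂_s ω + [Ψ, ω] - ω + ⋆ F_A)`,
augmented by the gauge-fixing component:
* `α`-component: `∇_s α + ⋆[ω ∧ α] + (-1)^{n+1} ⋆ d_A v - d_A ψ`;
* `v`-component: `∇_s v + ⋆ d_A α - v - [ω ∧ ψ]`;
* `ψ`-component: `∇_s ψ - d_A^* α + ⋆[ω ∧ ⋆v]`.

For `n = 2` one has `⋆[ω ∧ ⋆v] = [ω ∧ v]`. -/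
def linearizedOperator (hn : 2 ≤ n) (pr : P → Y)
    (o : ∀ y : Y, Orientation ℝ (TangentSpace (𝓡 n) y) (Fin n))
    (A : ℝ → ∀ p : P, TangentSpace (𝓡 (n + d)) p →L[ℝ] GroupLieAlgebra (𝓡 d) G)
    (om : ℝ → AdForm n d G pr (n - 2)) (Ψ : ℝ → AdForm n d G pr 0)
    (u : TripleField n d G pr) : TripleField n d G pr :=
  let α : ℝ → AdForm n d G pr 1 := fun s p => (u s p).1
  let v : ℝ → AdForm n d G pr (n - 2) := fun s p => (u s p).2.1
  let ψ : ℝ → AdForm n d G pr 0 := fun s p => (u s p).2.2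
  fun s p =>
    (nablaS pr Ψ α s p
        + hodgeStar (o (pr p)) (show n - 2 + 1 + 1 = n by omega)
            (wedgeBracket (rfl : n - 2 + 1 = n - 2 + 1) (om s p) (α s p))
        + (-1 : ℝ) ^ (n + 1) • adStar pr o (show n - 2 + 1 + 1 = n by omega)
            (covExtDeriv pr (A s) (v s)) p
        - covExtDeriv pr (A s) (ψ s) p,
      nablaS pr Ψ v s p
        + adStar pr o (show 1 + 1 + (n - 2) = n by omega) (covExtDeriv pr (A s) (α s)) p
        - v s p
        - wedgeBracket (Nat.add_zero (n - 2)) (om s p) (ψ s p),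
      nablaS pr Ψ ψ s p
        - covCoderiv hn pr o (A s) (α s) p
        + hodgeStar (o (pr p)) (Nat.add_zero n)
            (wedgeBracket (show n - 2 + 2 = n by omega) (om s p)
              (hodgeStar (o (pr p)) (show n - 2 + 2 = n by omega) (v s p))))

end Operator

end

/-! The operator is linear of first order, so its value on `f u` at a zero of `f` is its principal
symbol `σ(τ, ξ)` at `df = τ ds + ξ` applied to `u`: it arises by replacing `∂_s` with `τ` and `d_A`
with `ξ ∧ ·`, and the terms with `ω` and `Ψ` drop out. Every value at a point extends to a smooth
triple, so the operator is elliptic if and only if `σ(τ, ξ)` is bijective for `(τ, ξ) ≠ 0`.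

For `n = 2` one has `σ(τ, -ξ) σ(τ, ξ) = τ² + |ξ|²`. For `n ≥ 3` the component `v` has degree
`n - 2 ≥ 1`, and taking `τ = 0` and `v ≠ 0` with `ξ ∧ v = 0` gives `σ(0, ξ) (0, v, 0) = 0`. -/

noncomputable section

section CovectorWedge

variable {R V V' W : Type*} [CommRing R] [TopologicalSpace R]
  [AddCommGroup V] [Module R V] [TopologicalSpace V]
  [AddCommGroup V'] [Module R V'] [TopologicalSpace V']
  [AddCommGroup W] [Module R W] [TopologicalSpace W] [IsTopologicalAddGroup W]
  [ContinuousSMul R W] {k : ℕ}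

/-- The exterior product `ξ ∧ α` of a covector `ξ` and an alternating form `α`, as a linear function
of `α`, with the convention that `d(f α) = df ∧ α` at a zero of the function `f`. -/
def covectorWedge (ξ : V →L[R] R) : (V [⋀^Fin k]→L[R] W) →ₗ[R] V [⋀^Fin (k + 1)]→L[R] W where
  toFun α :=
    { AlternatingMap.alternatizeUncurryFin
        ((ξ : V →ₗ[R] R).smulRight α.toAlternatingMap) with
      cont := by
        change Continuous fun w : Fin (k + 1) → V => AlternatingMap.alternatizeUncurryFin
          ((ξ : V →ₗ[R] R).smulRight α.toAlternatingMap) w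
        simp only [AlternatingMap.alternatizeUncurryFin_apply]
        refine continuous_finsetSum _ fun i _ => .const_smul ?_ ((-1 : ℤ) ^ (i : ℕ))
        exact (ξ.continuous.comp (continuous_apply i)).smul
          (α.cont.comp (continuous_pi fun j => continuous_apply (i.succAbove j))) }
  map_add' α β := ContinuousAlternatingMap.toAlternatingMap_injective <|
    map_add (AlternatingMap.alternatizeUncurryFinLM ∘ₗ LinearMap.smulRightₗ (ξ : V →ₗ[R] R))
      α.toAlternatingMap β.toAlternatingMap
  map_smul' c α := ContinuousAlternatingMap.toAlternatingMap_injective <|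
    map_smul (AlternatingMap.alternatizeUncurryFinLM ∘ₗ LinearMap.smulRightₗ (ξ : V →ₗ[R] R))
      c α.toAlternatingMap

theorem covectorWedge_apply (ξ : V →L[R] R) (α : V [⋀^Fin k]→L[R] W) (w : Fin (k + 1) → V) :
    covectorWedge ξ α w = ∑ i : Fin (k + 1), (-1 : ℤ) ^ (i : ℕ) • ξ (w i) • α (i.removeNth w) :=
  AlternatingMap.alternatizeUncurryFin_apply _ _

theorem covectorWedge_one_apply (ξ : V →L[R] R) (α : V [⋀^Fin 1]→L[R] W) (w : Fin 2 → V) :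
    covectorWedge ξ α w = ξ (w 0) • (α fun _ => w 1) - ξ (w 1) • α fun _ => w 0 := by
  rw [covectorWedge_apply, Fin.sum_univ_two, sub_eq_add_neg]
  have h₀ : Fin.removeNth 0 w = fun _ => w 1 := funext fun i => by rw [Subsingleton.elim i 0]; rfl
  have h₁ : Fin.removeNth 1 w = fun _ => w 0 := funext fun i => by rw [Subsingleton.elim i 0]; rfl
  simp [h₀, h₁]

theorem covectorWedge_compContinuousLinearMap (ξ : V →L[R] R) (α : V [⋀^Fin k]→L[R] W)
    (L : V' →L[R] V) :
    (covectorWedge ξ α).compContinuousLinearMap L =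
      covectorWedge (ξ.comp L) (α.compContinuousLinearMap L) := by
  ext w
  simp only [ContinuousAlternatingMap.compContinuousLinearMap_apply, covectorWedge_apply]
  rfl

end CovectorWedge

section Calculus

open Topology

variable {E W : Type*} [NormedAddCommGroup E] [NormedSpace ℝ E]
  [NormedAddCommGroup W] [NormedSpace ℝ W]

theorem hasFDerivAt_smul_of_eq_zero {f : E → ℝ} {f' : E →L[ℝ] ℝ} {g : E → W} {x : E}
    (hf : HasFDerivAt f f' x) (hx : f x = 0) (hg : ContinuousAt g x) :
    HasFDerivAt (fun y => f y • g y) (f'.smulRight (g x)) x := by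
  have h_const : HasFDerivAt (fun y => f y • g x) (f'.smulRight (g x)) x := hf.smul_const (g x)
  have h_rest : HasFDerivAt (fun y => f y • (g y - g x)) (0 : E →L[ℝ] W) x := by
    refine HasFDerivAt.of_isLittleO ?_
    have hO : f =O[𝓝 x] fun y => y - x := by simpa [hx] using hf.isBigO_sub
    have ho : (fun y => g y - g x) =o[𝓝 x] fun _ => (1 : ℝ) := by
      rw [Asymptotics.isLittleO_one_iff]
      simpa using hg.tendsto.sub_const (g x)
    have h := hO.norm_right.smul_isLittleO ho
    refine (h.congr_right (g₂ := fun y => ‖y - x‖) fun y => by simp).of_norm_right.congr_left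
      fun y => by simp
  convert h_const.add h_rest using 1
  · funext y
    simp [← smul_add]
  · simp

theorem deriv_smul_of_eq_zero {f : ℝ → ℝ} {f' : ℝ} {g : ℝ → W} {x : ℝ}
    (hf : HasDerivAt f f' x) (hx : f x = 0) (hg : ContinuousAt g x) :
    deriv (fun y => f y • g y) x = f' • g x := by
  simpa using (hasFDerivAt_smul_of_eq_zero hf.hasFDerivAt hx hg).hasDerivAt.deriv

theorem extDeriv_smul_of_eq_zero {k : ℕ} {f : E → ℝ} {f' : E →L[ℝ] ℝ} {g : E → E [⋀^Fin k]→L[ℝ] W}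
    {x : E} (hf : HasFDerivAt f f' x) (hx : f x = 0) (hg : ContinuousAt g x) :
    extDeriv (fun y => f y • g y) x = covectorWedge f' (g x) := by
  rw [extDeriv, (hasFDerivAt_smul_of_eq_zero hf hx hg).fderiv]
  ext w
  simp [ContinuousAlternatingMap.alternatizeUncurryFin_apply, covectorWedge_apply]

theorem exists_eval_leftInverse (V F : Type*) [NormedAddCommGroup V] [NormedSpace ℝ V]
    [FiniteDimensional ℝ V] [NormedAddCommGroup F] [NormedSpace ℝ F] [FiniteDimensional ℝ F]
    (k : ℕ) :
    ∃ S : ((Fin k → Fin (finrank ℝ V)) → F) →L[ℝ] V [⋀^Fin k]→L[ℝ] F,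
      ∀ α : V [⋀^Fin k]→L[ℝ] F, S (fun j => α fun i => finBasis ℝ V (j i)) = α := by
  let T : (V [⋀^Fin k]→L[ℝ] F) →ₗ[ℝ] ((Fin k → Fin (finrank ℝ V)) → F) :=
    { toFun := fun α j => α fun i => finBasis ℝ V (j i)
      map_add' := fun _ _ => rfl
      map_smul' := fun _ _ => rfl }
  have hT : LinearMap.ker T = ⊥ := by
    rw [LinearMap.ker_eq_bot']
    intro α hα
    refine ContinuousAlternatingMap.toAlternatingMap_injective
      (AlternatingMap.coe_multilinearMap_injective ?_)
    exact Basis.ext_multilinear (fun _ => finBasis ℝ V) fun j => congrFun hα j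
  obtain ⟨S, hS⟩ := LinearMap.exists_leftInverse_of_injective T hT
  exact ⟨S.toContinuousLinearMap, fun α => LinearMap.congr_fun hS α⟩

variable {V F : Type*} [NormedAddCommGroup V] [NormedSpace ℝ V] [FiniteDimensional ℝ V]
  [NormedAddCommGroup F] [NormedSpace ℝ F] [FiniteDimensional ℝ F] {k : ℕ}

theorem continuousAt_continuousAlternatingMap {X : Type*} [TopologicalSpace X]
    {f : X → V [⋀^Fin k]→L[ℝ] F} {x : X} (h : ∀ w : Fin k → V, ContinuousAt (fun y => f y w) x) :
    ContinuousAt f x := by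
  obtain ⟨S, hS⟩ := exists_eval_leftInverse V F k
  have := S.continuous.continuousAt.comp
    (continuousAt_pi.2 fun j => h fun i => finBasis ℝ V (j i))
  simpa [Function.comp_def, hS] using this

theorem contDiffOn_continuousAlternatingMap {m : ℕ∞ω} {f : E → V [⋀^Fin k]→L[ℝ] F} {s : Set E}
    (h : ∀ w : Fin k → V, ContDiffOn ℝ m (fun y => f y w) s) : ContDiffOn ℝ m f s := by
  obtain ⟨S, hS⟩ := exists_eval_leftInverse V F k
  have := S.contDiff.comp_contDiffOn
    (contDiffOn_pi.2 fun j => h fun i => finBasis ℝ V (j i))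
  simpa [Function.comp_def, hS] using this

end Calculus

section HodgeStar

open Matrix

variable {V : Type*} [NormedAddCommGroup V] [InnerProductSpace ℝ V] [FiniteDimensional ℝ V]
  {W : Type*} [NormedAddCommGroup W] [NormedSpace ℝ W] {n k l : ℕ}

/-- The vector `ξ♯` metrically dual to the covector `ξ`. -/
def sharp (ξ : V →L[ℝ] ℝ) : V :=
  haveI := FiniteDimensional.complete ℝ V
  (InnerProductSpace.toDual ℝ V).symm ξ

theorem inner_sharp (ξ : V →L[ℝ] ℝ) (x : V) : inner ℝ (sharp ξ) x = ξ x :=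
  haveI := FiniteDimensional.complete ℝ V
  InnerProductSpace.toDual_symm_apply

theorem sharp_eq_of_inner_eq {ξ : V →L[ℝ] ℝ} {y : V} (h : ∀ x, inner ℝ y x = ξ x) : sharp ξ = y :=
  ext_inner_right ℝ fun x => by rw [inner_sharp, h]

theorem sharp_neg (ξ : V →L[ℝ] ℝ) : sharp (-ξ) = -sharp ξ :=
  sharp_eq_of_inner_eq fun x => by simp [inner_neg_left, inner_sharp]

theorem sharp_ne_zero {ξ : V →L[ℝ] ℝ} (hξ : ξ ≠ 0) : sharp ξ ≠ 0 := by
  rintro h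
  refine hξ (ContinuousLinearMap.ext fun x => ?_)
  rw [← inner_sharp, h, inner_zero_left, _root_.zero_apply]

theorem sum_apply_smul_apply {ι : Type*} [Fintype ι] (e : OrthonormalBasis ι ℝ V) (ξ : V →L[ℝ] ℝ)
    (L : V →ₗ[ℝ] W) : ∑ i, ξ (e i) • L (e i) = L (sharp ξ) := by
  conv_rhs => rw [← e.sum_repr' (sharp ξ)]
  simp only [map_sum, map_smul, real_inner_comm, inner_sharp]

theorem sharp_eq_sum_gram_inv {X : Fin n → V} (hn : finrank ℝ V = n) (hX : (gram ℝ X).det ≠ 0)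
    (ξ : V →L[ℝ] ℝ) : sharp ξ = ∑ j, ((gram ℝ X)⁻¹ *ᵥ fun i => ξ (X i)) j • X j := by
  have hspan : ⊤ ≤ Submodule.span ℝ (Set.range X) :=
    ((linearIndependent_of_det_gram_ne_zero hX).span_eq_top_of_card_eq_finrank'
      (by simp [hn])).ge
  set c := (gram ℝ X)⁻¹ *ᵥ fun i => ξ (X i)
  have hc : gram ℝ X *ᵥ c = fun i => ξ (X i) := by
    rw [mulVec_mulVec, mul_nonsing_inv _ (isUnit_iff_ne_zero.2 hX), one_mulVec]
  have hX' : ∀ i, inner ℝ (∑ j, c j • X j) (X i) = ξ (X i) := fun i => by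
    rw [← congrFun hc i]
    simp only [sum_inner, real_inner_smul_left, mulVec, dotProduct, gram_apply]
    exact Finset.sum_congr rfl fun j _ => by rw [real_inner_comm, mul_comm]
  refine sharp_eq_of_inner_eq fun x => ?_
  exact LinearMap.congr_fun (LinearMap.ext_on_range
    (f := (innerSL ℝ (∑ j, c j • X j)).toLinearMap) (g := ξ.toLinearMap)
    (top_le_iff.1 hspan) hX') x

variable [Fact (finrank ℝ V = n)] (o : Orientation ℝ V (Fin n))

theorem hodgeStar_apply (h : k + l = n) (α : V [⋀^Fin k]→L[ℝ] W) (w : Fin l → V) :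
    hodgeStar o h α w = (k ! : ℝ)⁻¹ • ∑ f : Fin k → Fin (finrank ℝ V),
      volForm o (fun i => Fin.append (fun j => stdOrthonormalBasis ℝ V (f j)) w
        (Fin.cast h.symm i)) • α (fun i => stdOrthonormalBasis ℝ V (f i)) := by
  simp only [hodgeStar, ContinuousAlternatingMap.smul_apply, ContinuousAlternatingMap.sum_apply]
  rfl

/-- The Hodge star as a linear map. -/
def hodgeStarLinear (h : k + l = n) : (V [⋀^Fin k]→L[ℝ] W) →ₗ[ℝ] V [⋀^Fin l]→L[ℝ] W where
  toFun := hodgeStar o h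
  map_add' α β := by
    ext w
    simp only [hodgeStar_apply, ContinuousAlternatingMap.add_apply, smul_add,
      Finset.sum_add_distrib]
  map_smul' c α := by
    ext w
    simp only [hodgeStar_apply, ContinuousAlternatingMap.smul_apply, smul_comm _ c,
      ← Finset.smul_sum, RingHom.id_apply]

/-- The covector `vol(·, w₁, …, w_{n-1})`. -/
def volCovector (h : 1 + l = n) (w : Fin l → V) : V →L[ℝ] ℝ :=
  (volForm o).toContinuousLinearMap
    (fun i => Fin.append (fun _ : Fin 1 => (0 : V)) w (Fin.cast h.symm i)) ⟨0, by omega⟩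

omit [FiniteDimensional ℝ V] in
theorem volCovector_apply (h : 1 + l = n) (w : Fin l → V) (x : V) :
    volCovector o h w x =
      volForm o fun i => Fin.append (fun _ : Fin 1 => x) w (Fin.cast h.symm i) := by
  subst h
  refine congrArg (volForm o) (funext fun i => ?_)
  refine Fin.addCases (fun j => ?_) (fun j => ?_) i
  · rw [Subsingleton.elim j 0]
    exact (Function.update_self _ _ _).trans (by simp)
  · exact (Function.update_of_ne (by simp [Fin.ext_iff]) _ _).trans (by simp)

theorem hodgeStar_one_apply (h : 1 + l = n) (α : V [⋀^Fin 1]→L[ℝ] W) (w : Fin l → V) :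
    hodgeStar o h α w = α fun _ => sharp (volCovector o h w) := by
  let L : V →L[ℝ] W := (ContinuousAlternatingMap.ofSubsingleton ℝ V W (0 : Fin 1)).symm α
  have hL : ∀ x, α (fun _ => x) = L x := fun x => rfl
  rw [hodgeStar_apply, hL]
  refine Eq.trans ?_ (sum_apply_smul_apply (stdOrthonormalBasis ℝ V) _ L.toLinearMap)
  rw [Nat.factorial_one, Nat.cast_one, inv_one, one_smul]
  refine Fintype.sum_equiv (Equiv.funUnique (Fin 1) _) _ _ fun f => ?_
  rw [show f = fun _ => f 0 from funext fun i => by rw [Subsingleton.elim i 0], hL]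
  rw [volCovector_apply]
  rfl

theorem hodgeStar_one_apply_eq_sum (h : 1 + l = n) {X : Fin n → V} (hX : (gram ℝ X).det ≠ 0)
    (α : V [⋀^Fin 1]→L[ℝ] W) (w : Fin l → V) :
    hodgeStar o h α w = ∑ j, ((gram ℝ X)⁻¹ *ᵥ fun i => volForm o fun a =>
      Fin.append (fun _ : Fin 1 => X i) w (Fin.cast h.symm a)) j • α fun _ => X j := by
  let L : V →L[ℝ] W := (ContinuousAlternatingMap.ofSubsingleton ℝ V W (0 : Fin 1)).symm α
  have hL : ∀ x, α (fun _ => x) = L x := fun x => rfl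
  rw [hodgeStar_one_apply, sharp_eq_sum_gram_inv Fact.out hX]
  simp only [hL, map_sum, map_smul, volCovector_apply]

end HodgeStar

section Surface

variable {V : Type*} [NormedAddCommGroup V] [InnerProductSpace ℝ V] [FiniteDimensional ℝ V]
  [Fact (finrank ℝ V = 2)] {W : Type*} [NormedAddCommGroup W] [NormedSpace ℝ W]
  (o : Orientation ℝ V (Fin 2))

omit [FiniteDimensional ℝ V] in
theorem volForm_eq_areaForm (w : Fin 2 → V) : volForm o w = o.areaForm (w 0) (w 1) := by
  rw [o.areaForm_to_volumeForm]
  exact congrArg o.volumeForm (List.ofFn_inj.1 rfl)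

theorem sharp_areaForm_left (x : V) :
    sharp (o.areaForm x).toContinuousLinearMap = o.rightAngleRotation x :=
  sharp_eq_of_inner_eq fun y => o.inner_rightAngleRotation_left x y

theorem hodgeStar_one_apply_surface (h : 1 + 1 = 2) (α : V [⋀^Fin 1]→L[ℝ] W) (w : Fin 1 → V) :
    hodgeStar o h α w = -α fun _ => o.rightAngleRotation (w 0) := by
  have hvol : volCovector o h w = -(o.areaForm (w 0)).toContinuousLinearMap := by
    ext x
    rw [volCovector_apply, volForm_eq_areaForm, o.areaForm_swap]
    rfl
  let L : V →L[ℝ] W := (ContinuousAlternatingMap.ofSubsingleton ℝ V W (0 : Fin 1)).symm α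
  rw [hodgeStar_one_apply, hvol, sharp_neg, sharp_areaForm_left]
  exact map_neg L _

theorem hodgeStar_covectorWedge_zero_surface (h : 1 + 1 = 2) (ξ : V →L[ℝ] ℝ)
    (v : V [⋀^Fin 0]→L[ℝ] W) (w : Fin 1 → V) :
    hodgeStar o h (covectorWedge (k := 0) ξ v) w =
      inner ℝ (o.rightAngleRotation (sharp ξ)) (w 0) • v ![] := by
  rw [hodgeStar_one_apply_surface, covectorWedge_apply, o.inner_rightAngleRotation_swap',
    inner_sharp, Fin.sum_univ_one, neg_smul, Fin.val_zero, pow_zero, one_smul,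
    Subsingleton.elim (Fin.removeNth _ _) ![]]

theorem hodgeStar_two_apply_surface (h : 1 + 1 + 0 = 2) (β : V [⋀^Fin 2]→L[ℝ] W) (w : Fin 0 → V) :
    hodgeStar o h β w = (2 : ℝ)⁻¹ • ∑ i, β ![stdOrthonormalBasis ℝ V i,
      o.rightAngleRotation (stdOrthonormalBasis ℝ V i)] := by
  set e := stdOrthonormalBasis ℝ V with he
  have hsum : ∀ i, ∑ j, o.areaForm (e i) (e j) • β ![e i, e j] =
      β ![e i, o.rightAngleRotation (e i)] := fun i => by
    have hupdate : ∀ x, Function.update ![e i, 0] 1 x = ![e i, x] := fun x =>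
      List.ofFn_inj.1 rfl
    have := sum_apply_smul_apply e (o.areaForm (e i)).toContinuousLinearMap
      (β.toContinuousLinearMap ![e i, 0] 1).toLinearMap
    rw [sharp_areaForm_left] at this
    simpa [hupdate] using this
  have hpair : ∀ f : Fin 2 → Fin (finrank ℝ V), (fun i => e (f i)) = ![e (f 0), e (f 1)] :=
    fun f => List.ofFn_inj.1 rfl
  have happend : ∀ x : Fin 2 → V, (fun i => Fin.append x w (Fin.cast h.symm i)) = x :=
    fun x => List.ofFn_inj.1 rfl
  rw [hodgeStar_apply, Nat.factorial_two, Nat.cast_ofNat, ← he,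
    ← Finset.sum_congr rfl fun i _ => hsum i, ← Fintype.sum_prod_type',
    Fintype.sum_equiv (finTwoArrowEquiv _)]
  intro f
  rw [happend, volForm_eq_areaForm, hpair]
  rfl

theorem hodgeStar_covectorWedge_one_surface (h : 1 + 1 + 0 = 2) (ξ : V →L[ℝ] ℝ)
    (α : V [⋀^Fin 1]→L[ℝ] W) (w : Fin 0 → V) :
    hodgeStar o h (covectorWedge ξ α) w = α fun _ => o.rightAngleRotation (sharp ξ) := by
  let e := stdOrthonormalBasis ℝ V
  let J : V →L[ℝ] V := o.rightAngleRotation.toContinuousLinearEquiv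
  let L : V →L[ℝ] W := (ContinuousAlternatingMap.ofSubsingleton ℝ V W (0 : Fin 1)).symm α
  have hJ : sharp (ξ.comp J) = -J (sharp ξ) := sharp_eq_of_inner_eq fun x => by
    rw [inner_neg_left, ContinuousLinearMap.comp_apply, ← inner_sharp ξ]
    exact (o.inner_rightAngleRotation_swap _ _).symm
  have hsum : ∑ i, (ξ (e i) • L (J (e i)) - ξ (J (e i)) • L (e i)) =
      L (J (sharp ξ)) + L (J (sharp ξ)) := by
    have h₁ := sum_apply_smul_apply e ξ (L.comp J).toLinearMap
    have h₂ := sum_apply_smul_apply e (ξ.comp J) L.toLinearMap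
    rw [hJ] at h₂
    rw [Finset.sum_sub_distrib]
    exact (congrArg₂ (· - ·) h₁ h₂).trans (by simp)
  have hL : ∀ i, covectorWedge ξ α ![e i, o.rightAngleRotation (e i)] =
      ξ (e i) • L (J (e i)) - ξ (J (e i)) • L (e i) := fun i => covectorWedge_one_apply ξ α _
  rw [hodgeStar_two_apply_surface, Finset.sum_congr rfl fun i _ => hL i, hsum, ← two_smul ℝ,
    inv_smul_smul₀ two_ne_zero]
  rfl

theorem hodgeStar_covectorWedge_hodgeStar_surface (h : 1 + 1 + 0 = 2) (h' : 1 + 1 = 2)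
    (ξ : V →L[ℝ] ℝ) (α : V [⋀^Fin 1]→L[ℝ] W) (w : Fin 0 → V) :
    hodgeStar o h (covectorWedge ξ (hodgeStar o h' α)) w = α fun _ => sharp ξ := by
  let L : V →L[ℝ] W := (ContinuousAlternatingMap.ofSubsingleton ℝ V W (0 : Fin 1)).symm α
  rw [hodgeStar_covectorWedge_one_surface, hodgeStar_one_apply_surface,
    o.rightAngleRotation_rightAngleRotation]
  exact (congrArg Neg.neg (map_neg L _)).trans (neg_neg _)

end Surface

section LinearizedSymbol

variable {V : Type*} [NormedAddCommGroup V] [InnerProductSpace ℝ V] [FiniteDimensional ℝ V]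
  {W : Type*} [NormedAddCommGroup W] [NormedSpace ℝ W] {n : ℕ} [Fact (finrank ℝ V = n)]

/-- The principal symbol of `∇_s + B_{(A,ω,Ψ)}` at the covector `τ ds + ξ`. -/
def linearizedSymbol (hn : 2 ≤ n) (o : Orientation ℝ V (Fin n)) (τ : ℝ) (ξ : V →L[ℝ] ℝ) :
    (V [⋀^Fin 1]→L[ℝ] W) × (V [⋀^Fin (n - 2)]→L[ℝ] W) × (V [⋀^Fin 0]→L[ℝ] W) →ₗ[ℝ]
      (V [⋀^Fin 1]→L[ℝ] W) × (V [⋀^Fin (n - 2)]→L[ℝ] W) × (V [⋀^Fin 0]→L[ℝ] W) :=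
  let α := LinearMap.fst ℝ (V [⋀^Fin 1]→L[ℝ] W) ((V [⋀^Fin (n - 2)]→L[ℝ] W) × (V [⋀^Fin 0]→L[ℝ] W))
  let vψ := LinearMap.snd ℝ (V [⋀^Fin 1]→L[ℝ] W)
    ((V [⋀^Fin (n - 2)]→L[ℝ] W) × (V [⋀^Fin 0]→L[ℝ] W))
  let v := LinearMap.fst ℝ (V [⋀^Fin (n - 2)]→L[ℝ] W) (V [⋀^Fin 0]→L[ℝ] W) ∘ₗ vψ
  let ψ := LinearMap.snd ℝ (V [⋀^Fin (n - 2)]→L[ℝ] W) (V [⋀^Fin 0]→L[ℝ] W) ∘ₗ vψ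
  (τ • α
      + (-1 : ℝ) ^ (n + 1) •
        (hodgeStarLinear o (show n - 2 + 1 + 1 = n by omega) ∘ₗ covectorWedge ξ ∘ₗ v)
      - covectorWedge ξ ∘ₗ ψ).prod <|
    (τ • v + hodgeStarLinear o (show 1 + 1 + (n - 2) = n by omega) ∘ₗ covectorWedge ξ ∘ₗ α).prod <|
    τ • ψ + hodgeStarLinear o (show n - 1 + 1 + 0 = n by omega) ∘ₗ covectorWedge ξ ∘ₗ
      hodgeStarLinear o (show 1 + (n - 1) = n by omega) ∘ₗ α

theorem linearizedSymbol_apply (hn : 2 ≤ n) (o : Orientation ℝ V (Fin n)) (τ : ℝ) (ξ : V →L[ℝ] ℝ)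
    (α : V [⋀^Fin 1]→L[ℝ] W) (v : V [⋀^Fin (n - 2)]→L[ℝ] W) (ψ : V [⋀^Fin 0]→L[ℝ] W) :
    linearizedSymbol hn o τ ξ (α, v, ψ) =
      (τ • α
          + (-1 : ℝ) ^ (n + 1) •
            hodgeStar o (show n - 2 + 1 + 1 = n by omega) (covectorWedge ξ v)
          - covectorWedge ξ ψ,
        τ • v + hodgeStar o (show 1 + 1 + (n - 2) = n by omega) (covectorWedge ξ α),
        τ • ψ + hodgeStar o (show n - 1 + 1 + 0 = n by omega)
          (covectorWedge ξ (hodgeStar o (show 1 + (n - 1) = n by omega) α))) :=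
  rfl

section Surface

variable [Fact (finrank ℝ V = 2)] (o : Orientation ℝ V (Fin 2)) (τ : ℝ) (ξ : V →L[ℝ] ℝ)
  (u : (V [⋀^Fin 1]→L[ℝ] W) × (V [⋀^Fin (2 - 2)]→L[ℝ] W) × (V [⋀^Fin 0]→L[ℝ] W))

theorem linearizedSymbol_surface_fst (w : Fin 1 → V) :
    (linearizedSymbol le_rfl o τ ξ u).1 w = τ • u.1 w
      - inner ℝ (o.rightAngleRotation (sharp ξ)) (w 0) • u.2.1 ![]
      - inner ℝ (sharp ξ) (w 0) • u.2.2 ![] := by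
  have hv := hodgeStar_covectorWedge_zero_surface o rfl ξ u.2.1 w
  have hψ : covectorWedge ξ u.2.2 w = inner ℝ (sharp ξ) (w 0) • u.2.2 ![] := by
    rw [covectorWedge_apply, Fin.sum_univ_one, inner_sharp, Fin.val_zero, pow_zero, one_smul,
      Subsingleton.elim (Fin.removeNth _ _) ![]]
  rw [← hv, ← hψ, sub_eq_add_neg (τ • u.1 w), ← neg_one_smul ℝ (hodgeStar _ _ _ _),
    show (-1 : ℝ) = (-1) ^ (2 + 1) by norm_num]
  rfl

theorem linearizedSymbol_surface_snd (w : Fin 0 → V) :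
    (linearizedSymbol le_rfl o τ ξ u).2.1 w =
      τ • u.2.1 ![] + u.1 fun _ => o.rightAngleRotation (sharp ξ) := by
  rw [← hodgeStar_covectorWedge_one_surface o rfl ξ u.1 w, Subsingleton.elim ![] w]
  rfl

theorem linearizedSymbol_surface_thd (w : Fin 0 → V) :
    (linearizedSymbol le_rfl o τ ξ u).2.2 w = τ • u.2.2 ![] + u.1 fun _ => sharp ξ := by
  rw [← hodgeStar_covectorWedge_hodgeStar_surface o rfl rfl ξ u.1 w, Subsingleton.elim ![] w]
  rfl

omit [FiniteDimensional ℝ V] in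
theorem inner_smul_add_inner_rightAngleRotation_smul (x y : V) :
    inner ℝ x y • x + inner ℝ (o.rightAngleRotation x) y • o.rightAngleRotation x =
      ‖x‖ ^ 2 • y :=
  ext_inner_right ℝ fun z => by
    simp only [inner_add_left, real_inner_smul_left, o.inner_rightAngleRotation_left]
    exact o.inner_mul_inner_add_areaForm_mul_areaForm x y z

theorem linearizedSymbol_neg_linearizedSymbol :
    linearizedSymbol le_rfl o τ (-ξ) (linearizedSymbol le_rfl o τ ξ u) =
      (τ ^ 2 + ‖sharp ξ‖ ^ 2) • u := by
  let L : V →L[ℝ] W := (ContinuousAlternatingMap.ofSubsingleton ℝ V W (0 : Fin 1)).symm u.1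
  have hL : ∀ w : Fin 1 → V, u.1 w = L (w 0) := fun w =>
    congrArg u.1 (funext fun i => by rw [Subsingleton.elim i 0])
  have hx : inner ℝ (sharp ξ) (sharp ξ) = ‖sharp ξ‖ ^ 2 := real_inner_self_eq_norm_sq _
  refine Prod.ext (ContinuousAlternatingMap.ext fun w => ?_)
    (Prod.ext (ContinuousAlternatingMap.ext fun (w : Fin 0 → V) => ?_)
      (ContinuousAlternatingMap.ext fun w => ?_))
  · change _ = (τ ^ 2 + ‖sharp ξ‖ ^ 2) • u.1 w
    have := congrArg L (inner_smul_add_inner_rightAngleRotation_smul o (sharp ξ) (w 0))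
    simp only [map_add, map_smul] at this
    simp only [linearizedSymbol_surface_fst, linearizedSymbol_surface_snd,
      linearizedSymbol_surface_thd, sharp_neg, map_neg, inner_neg_left, hL, add_smul, ← this]
    module
  · change _ = (τ ^ 2 + ‖sharp ξ‖ ^ 2) • u.2.1 w
    simp only [Subsingleton.elim w ![], linearizedSymbol_surface_fst, linearizedSymbol_surface_snd,
      sharp_neg, map_neg, inner_neg_right, o.inner_rightAngleRotation_self,
      o.inner_comp_rightAngleRotation, o.inner_rightAngleRotation_swap, hx, hL]
    module
  · change _ = (τ ^ 2 + ‖sharp ξ‖ ^ 2) • u.2.2 w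
    simp only [Subsingleton.elim w ![], linearizedSymbol_surface_fst, linearizedSymbol_surface_thd,
      sharp_neg, inner_neg_right, map_neg, o.inner_rightAngleRotation_self, hx, hL]
    module

theorem bijective_linearizedSymbol {τ : ℝ} {ξ : V →L[ℝ] ℝ} (h : τ ≠ 0 ∨ ξ ≠ 0) :
    Function.Bijective (linearizedSymbol (W := W) le_rfl o τ ξ) := by
  have hpos : τ ^ 2 + ‖sharp ξ‖ ^ 2 ≠ 0 := by
    rcases h with hτ | hξ
    · positivity
    · have := norm_pos_iff.2 (sharp_ne_zero hξ)
      positivity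
  refine Function.bijective_iff_has_inverse.2
    ⟨fun u => (τ ^ 2 + ‖sharp ξ‖ ^ 2)⁻¹ • linearizedSymbol le_rfl o τ (-ξ) u,
      fun u => ?_, fun u => ?_⟩
  · simp only [linearizedSymbol_neg_linearizedSymbol, inv_smul_smul₀ hpos]
  · have := linearizedSymbol_neg_linearizedSymbol o τ (-ξ) u
    rw [neg_neg, sharp_neg, norm_neg] at this
    simp only [map_smul, this, inv_smul_smul₀ hpos]

end Surface

end LinearizedSymbol

section Degenerate

theorem exists_covectorWedge_eq_zero (V W : Type*) [NormedAddCommGroup V] [NormedSpace ℝ V]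
    [FiniteDimensional ℝ V] [NormedAddCommGroup W] [NormedSpace ℝ W] [Nontrivial W]
    {k : ℕ} (hk : 1 ≤ k) (hk' : k ≤ finrank ℝ V) :
    ∃ ξ : V →L[ℝ] ℝ, ξ ≠ 0 ∧ ∃ v : V [⋀^Fin k]→L[ℝ] W, v ≠ 0 ∧ covectorWedge ξ v = 0 := by
  let E := EuclideanSpace ℝ (Fin k)
  let e : OrthonormalBasis (Fin k) ℝ E := EuclideanSpace.basisFun (Fin k) ℝ
  obtain ⟨q, hq⟩ : ∃ q : V →L[ℝ] E, Function.Surjective q := by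
    obtain ⟨x, hx⟩ := exists_linearIndependent_of_le_finrank hk'
    let i : E →ₗ[ℝ] V := e.toBasis.constr ℝ x
    obtain ⟨q, hq⟩ := i.exists_leftInverse_of_injective
      (LinearMap.ker_eq_bot.2 (e.toBasis.injective_constr_of_linearIndependent hx))
    exact ⟨q.toContinuousLinearMap, fun x => ⟨i x, LinearMap.congr_fun hq x⟩⟩
  have : Fact (finrank ℝ E = k) := ⟨finrank_euclideanSpace_fin⟩
  obtain ⟨w₀, hw₀⟩ := exists_ne (0 : W)
  -- Every `(k + 1)`-form on `ℝᵏ` vanishes, so pull back the volume form of `ℝᵏ`.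
  let μ : E [⋀^Fin k]→L[ℝ] W := (volForm e.toBasis.orientation).smulRight w₀
  refine ⟨(innerSL ℝ (e ⟨0, hk⟩)).comp q, fun h => ?_, μ.compContinuousLinearMap q, fun h => ?_, ?_⟩
  · obtain ⟨x, hx⟩ := hq (e ⟨0, hk⟩)
    have := DFunLike.congr_fun h x
    simp [hx] at this
  · choose x hx using fun i => hq (e i)
    have hvol : volForm e.toBasis.orientation e ≠ 0 := fun h₀ => by
      have := e.toBasis.orientation.abs_volumeForm_apply_of_orthonormal e
      exact zero_ne_one ((abs_eq_zero.2 h₀).symm.trans this)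
    have := DFunLike.congr_fun h x
    simp [μ, Function.comp_def, hx, hvol, hw₀] at this
  · rw [← covectorWedge_compContinuousLinearMap]
    ext w
    refine AlternatingMap.map_linearDependent (covectorWedge _ μ).toAlternatingMap (q ∘ w)
      fun h => ?_
    simpa [E] using h.fintype_card_le_finrank

theorem not_injective_linearizedSymbol (V W : Type*) [NormedAddCommGroup V] [InnerProductSpace ℝ V]
    [FiniteDimensional ℝ V] [NormedAddCommGroup W] [NormedSpace ℝ W] [Nontrivial W] {n : ℕ}
    [Fact (finrank ℝ V = n)] (hn : 2 < n) :
    ∃ ξ : V →L[ℝ] ℝ, ξ ≠ 0 ∧ ∀ o : Orientation ℝ V (Fin n),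
      ¬ Function.Injective (linearizedSymbol (W := W) hn.le o 0 ξ) := by
  obtain ⟨ξ, hξ, v, hv, hξv⟩ := exists_covectorWedge_eq_zero V W (k := n - 2)
    (by omega) (by rw [Fact.out (p := finrank ℝ V = n)]; omega)
  refine ⟨ξ, hξ, fun o hinj => hv ?_⟩
  have hstar : ∀ {k l : ℕ} (h : k + l = n), hodgeStar o h (0 : V [⋀^Fin k]→L[ℝ] W) = 0 :=
    fun h => (hodgeStarLinear o h).map_zero
  have h : linearizedSymbol hn.le o 0 ξ (0, v, 0) = 0 := by
    simp only [linearizedSymbol_apply, hξv, hstar, map_zero, smul_zero, add_zero, sub_zero,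
      zero_smul, Prod.mk_zero_zero]
  exact congrArg (fun u => u.2.1) (hinj (h.trans (map_zero _).symm))

end Degenerate

section ManifoldForms

variable {m k : ℕ} {M : Type*} [TopologicalSpace M] [ChartedSpace (EuclideanSpace ℝ (Fin m)) M]
  {F : Type*} [NormedAddCommGroup F] [NormedSpace ℝ F]

theorem SmoothFormsOn.continuousAt_space {I : Set ℝ} {α : ℝ → MForm m M F k}
    (h : SmoothFormsOn I α) (hI : IsOpen I) {s : ℝ} (hs : s ∈ I) (x : M) :
    ContinuousAt (chartForm (α s) x) (extChartAt (𝓡 m) x x) := by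
  have h1 := (h x).continuousOn.continuousAt (x := (s, extChartAt (𝓡 m) x x))
    (prod_mem_nhds (hI.mem_nhds hs) (extChartAt_target_mem_nhds x))
  exact h1.comp (f := fun u => (s, u)) (by fun_prop)

theorem SmoothFormsOn.continuousAt_time {I : Set ℝ} {α : ℝ → MForm m M F k}
    (h : SmoothFormsOn I α) (hI : IsOpen I) {s : ℝ} (hs : s ∈ I) (x : M) :
    ContinuousAt (fun t => chartForm (α t) x (extChartAt (𝓡 m) x x)) s := by
  have h1 := (h x).continuousOn.continuousAt (x := (s, extChartAt (𝓡 m) x x))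
    (prod_mem_nhds (hI.mem_nhds hs) (extChartAt_target_mem_nhds x))
  exact h1.comp (f := fun t => (t, extChartAt (𝓡 m) x x)) (by fun_prop)

variable [IsManifold (𝓡 m) ∞ M]

theorem mfderiv_extChartAt_symm_self (x : M) :
    mfderiv (𝓡 m) (𝓡 m) (extChartAt (𝓡 m) x).symm (extChartAt (𝓡 m) x x) =
      ContinuousLinearMap.id ℝ (EuclideanSpace ℝ (Fin m)) := by
  have h := mfderivWithin_range_extChartAt_symm (I := 𝓡 m) (x := x)
  rwa [ModelWithCorners.range_eq_univ, mfderivWithin_univ] at h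

theorem chartForm_self (α : MForm m M F k) (x : M) :
    chartForm α x (extChartAt (𝓡 m) x x) = α x := by
  have key : ∀ q : M, q = x → ∀ w : Fin k → EuclideanSpace ℝ (Fin m), α q w = α x w := by
    rintro q rfl w
    rfl
  ext w
  refine Eq.trans (key _ (extChartAt_to_inv (I := 𝓡 m) x) _) (congrArg (α x) (funext fun i => ?_))
  exact congrArg (fun L : EuclideanSpace ℝ (Fin m) →L[ℝ] EuclideanSpace ℝ (Fin m) => L (w i))
    (mfderiv_extChartAt_symm_self x)

theorem mExtDeriv_eq_extDeriv_chartForm (α : MForm m M F k) (x : M) :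
    mExtDeriv α x = extDeriv (chartForm α x) (extChartAt (𝓡 m) x x) := by
  ext w
  refine congrArg (extDeriv (chartForm α x) (extChartAt (𝓡 m) x x)) (funext fun i => ?_)
  exact congrArg (fun L : EuclideanSpace ℝ (Fin m) →L[ℝ] EuclideanSpace ℝ (Fin m) => L (w i))
    (mfderiv_extChartAt_self (I := 𝓡 m) (x := x))

theorem mExtDeriv_smul_of_eq_zero {f : M → ℝ} {α : MForm m M F k} {x : M}
    (hf : MDifferentiableAt (𝓡 m) 𝓘(ℝ, ℝ) f x) (hx : f x = 0)
    (hα : ContinuousAt (chartForm α x) (extChartAt (𝓡 m) x x)) :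
    mExtDeriv (fun q => f q • α q) x = covectorWedge (mvfderiv (𝓡 m) f x) (α x) := by
  have hf' : HasFDerivAt (fun u => f ((extChartAt (𝓡 m) x).symm u))
      (mvfderiv (𝓡 m) f x : EuclideanSpace ℝ (Fin m) →L[ℝ] ℝ) (extChartAt (𝓡 m) x x) := by
    have h := hf.hasMFDerivAt.2
    rw [ModelWithCorners.range_eq_univ] at h
    exact HasFDerivWithinAt.hasFDerivAt_of_univ h
  rw [mExtDeriv_eq_extDeriv_chartForm]
  refine (extDeriv_smul_of_eq_zero hf' (by rwa [extChartAt_to_inv]) hα).trans ?_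
  rw [chartForm_self]
  rfl

end ManifoldForms

section PrincipalBundles

theorem isInvertible_prod {E F W : Type*} [NormedAddCommGroup E] [NormedSpace ℝ E]
    [NormedAddCommGroup F] [NormedSpace ℝ F] [NormedAddCommGroup W] [NormedSpace ℝ W]
    [FiniteDimensional ℝ E] [FiniteDimensional ℝ F] [FiniteDimensional ℝ W]
    (hdim : finrank ℝ E = finrank ℝ F + finrank ℝ W) {L : E →L[ℝ] F} {A : E →L[ℝ] W}
    {B : W →L[ℝ] E} (hL : Function.Surjective L) (hLB : ∀ X, L (B X) = 0)
    (hAB : ∀ X, A (B X) = X) : (L.prod A).IsInvertible := by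
  have hsurj : Function.Surjective (L.prod A : E →L[ℝ] F × W) := by
    rintro ⟨y, X⟩
    obtain ⟨w, rfl⟩ := hL y
    exact ⟨w + B (X - A w), by simp [hLB, hAB]⟩
  have hinj : Function.Injective (L.prod A : E →ₗ[ℝ] F × W) :=
    (LinearMap.injective_iff_surjective_of_finrank_eq_finrank (by simpa using hdim)).2 hsurj
  exact ⟨(LinearEquiv.ofBijective _ ⟨hinj, hsurj⟩).toContinuousLinearEquiv, rfl⟩

variable {n d : ℕ}
  {Y : Type*} [TopologicalSpace Y] [ChartedSpace (EuclideanSpace ℝ (Fin n)) Y]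
  {G : Type*} [TopologicalSpace G] [ChartedSpace (EuclideanSpace ℝ (Fin d)) G] [Group G]
  {P : Type*} [TopologicalSpace P] [ChartedSpace (EuclideanSpace ℝ (Fin (n + d))) P]
  [MulAction Gᵐᵒᵖ P] {pr : P → Y}

namespace IsPrincipalBundle

theorem mdifferentiableAt_proj (hpr : IsPrincipalBundle n d G pr) (p : P) :
    MDifferentiableAt (𝓡 (n + d)) (𝓡 n) pr p :=
  (hpr.contMDiff_proj p).mdifferentiableAt (by simp)

theorem mdifferentiableAt_act (hpr : IsPrincipalBundle n d G pr) (g : G) (p : P) :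
    MDifferentiableAt (𝓡 (n + d)) (𝓡 (n + d)) (fun q : P => MulOpposite.op g • q) p :=
  ((hpr.contMDiff_act (p, g)).mdifferentiableAt (by simp)).comp (f := fun q : P => (q, g)) p
    (mdifferentiableAt_id.prodMk mdifferentiableAt_const)

theorem mdifferentiableAt_orbit (hpr : IsPrincipalBundle n d G pr) (p : P) (g : G) :
    MDifferentiableAt (𝓡 d) (𝓡 (n + d)) (fun h : G => MulOpposite.op h • p) g :=
  ((hpr.contMDiff_act (p, g)).mdifferentiableAt (by simp)).comp (f := fun h : G => (p, h)) g
    (mdifferentiableAt_const.prodMk mdifferentiableAt_id)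

theorem surjective_proj (hpr : IsPrincipalBundle n d G pr) : Function.Surjective pr := by
  intro y
  obtain ⟨U, Φ, -, hy, -, ht, hΦ⟩ := hpr.locally_trivial y
  have hmem : (y, (1 : G)) ∈ Φ.target := by simp [ht, hy]
  exact ⟨Φ.symm (y, 1), (hΦ _ (Φ.map_target hmem)).1.symm.trans
    (congrArg Prod.fst (Φ.right_inv hmem))⟩

theorem exists_localSection (hpr : IsPrincipalBundle n d G pr) (p : P) :
    ∃ τ : Y → P, τ (pr p) = p ∧ MDifferentiableAt (𝓡 n) (𝓡 (n + d)) τ (pr p) ∧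
      pr ∘ τ =ᶠ[nhds (pr p)] id := by
  obtain ⟨U, Φ, hU, hy, hs, ht, hΦ⟩ := hpr.locally_trivial (pr p)
  have hp : p ∈ Φ.source := by rw [hs]; exact hy
  refine ⟨fun y => Φ.symm (y, (Φ p).2), ?_, ?_, ?_⟩
  · have hfst : (pr p, (Φ p).2) = Φ p := by rw [← (hΦ p hp).1]
    exact (congrArg Φ.symm hfst).trans (Φ.left_inv hp)
  · have hsymm : MDifferentiableAt ((𝓡 n).prod (𝓡 d)) (𝓡 (n + d)) Φ.symm (pr p, (Φ p).2) :=
      Φ.symm.mdifferentiableAt (by simp) (show _ ∈ Φ.target by simp [ht, hy])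
    exact hsymm.comp (pr p) (mdifferentiableAt_id.prodMk mdifferentiableAt_const)
  · filter_upwards [hU.mem_nhds hy] with y hy'
    have hmem : (y, (Φ p).2) ∈ Φ.target := by simp [ht, hy']
    exact (hΦ _ (Φ.map_target hmem)).1.symm.trans (congrArg Prod.fst (Φ.right_inv hmem))

theorem surjective_mfderiv (hpr : IsPrincipalBundle n d G pr) (p : P) :
    Function.Surjective (mfderiv (𝓡 (n + d)) (𝓡 n) pr p :
      EuclideanSpace ℝ (Fin (n + d)) →L[ℝ] EuclideanSpace ℝ (Fin n)) := by
  obtain ⟨τ, hτp, hτ, hprτ⟩ := hpr.exists_localSection p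
  have h := mfderiv_comp (pr p) (hpr.mdifferentiableAt_proj (τ (pr p))) hτ
  rw [hprτ.mfderiv_eq, mfderiv_id] at h
  intro y
  have hpoint : (mfderiv (𝓡 (n + d)) (𝓡 n) pr (τ (pr p)) :
      EuclideanSpace ℝ (Fin (n + d)) →L[ℝ] EuclideanSpace ℝ (Fin n)) =
      mfderiv (𝓡 (n + d)) (𝓡 n) pr p := mfderiv_congr_point hτp
  exact ⟨mfderiv (𝓡 n) (𝓡 (n + d)) τ (pr p) y,
    (DFunLike.congr_fun hpoint _).symm.trans (DFunLike.congr_fun h y).symm⟩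

variable {A : ∀ p : P, TangentSpace (𝓡 (n + d)) p →L[ℝ] GroupLieAlgebra (𝓡 d) G}

theorem isInvertible_prod_connection (hpr : IsPrincipalBundle n d G pr)
    (hA : IsConnectionForm A) (p : P) :
    ((mfderiv (𝓡 (n + d)) (𝓡 n) pr p).prod (A p)).IsInvertible := by
  let B : EuclideanSpace ℝ (Fin d) →L[ℝ] EuclideanSpace ℝ (Fin (n + d)) :=
    mfderiv (𝓡 d) (𝓡 (n + d)) (fun g : G => MulOpposite.op g • p) 1
  have hone : MulOpposite.op (1 : G) • p = p := by simp
  have hfinrank : finrank ℝ (GroupLieAlgebra (𝓡 d) G) = d :=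
    (finrank_euclideanSpace_fin : finrank ℝ (EuclideanSpace ℝ (Fin d)) = d)
  have h_vertical (X : EuclideanSpace ℝ (Fin d)) :
      (mfderiv (𝓡 (n + d)) (𝓡 n) pr p (B X) : EuclideanSpace ℝ (Fin n)) = 0 := by
    have h := mfderiv_comp (1 : G) (hpr.mdifferentiableAt_proj (MulOpposite.op (1 : G) • p))
      (hpr.mdifferentiableAt_orbit p 1)
    have hconst : pr ∘ (fun g : G => MulOpposite.op g • p) = fun _ => pr p :=
      funext fun g => hpr.proj_act p g
    rw [hconst, mfderiv_const] at h
    have hpoint : (mfderiv (𝓡 (n + d)) (𝓡 n) pr (MulOpposite.op (1 : G) • p) :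
        EuclideanSpace ℝ (Fin (n + d)) →L[ℝ] EuclideanSpace ℝ (Fin n)) =
        mfderiv (𝓡 (n + d)) (𝓡 n) pr p := mfderiv_congr_point hone
    exact (DFunLike.congr_fun hpoint _).symm.trans (DFunLike.congr_fun h X).symm
  have h_fundamental (X : EuclideanSpace ℝ (Fin d)) : A p (B X) = X := by
    have key : ∀ q : P, q = p → ∀ w : EuclideanSpace ℝ (Fin (n + d)), A q w = A p w := by
      rintro q rfl w
      rfl
    exact (key _ hone _).symm.trans (hA.fundamental p X)
  exact isInvertible_prod (E := EuclideanSpace ℝ (Fin (n + d))) (F := EuclideanSpace ℝ (Fin n))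
    (W := GroupLieAlgebra (𝓡 d) G) (B := B) (by rw [hfinrank]; simp) (hpr.surjective_mfderiv p)
    h_vertical h_fundamental

theorem mfderiv_horizontalLift (hpr : IsPrincipalBundle n d G pr)
    (hA : IsConnectionForm A) (p : P) (w : TangentSpace (𝓡 n) (pr p)) :
    mfderiv (𝓡 (n + d)) (𝓡 n) pr p (horizontalLift pr A p w) = w :=
  congrArg Prod.fst ((hpr.isInvertible_prod_connection hA p).self_apply_inverse (w, 0))

theorem pullbackForm_compContinuousLinearMap_horizontalLift (hpr : IsPrincipalBundle n d G pr)
    (hA : IsConnectionForm A) {k : ℕ} (α : AdForm n d G pr k) (p : P) :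
    (pullbackForm pr α p).compContinuousLinearMap (horizontalLift pr A p) = α p :=
  ContinuousAlternatingMap.ext fun w =>
    congrArg (α p) (funext fun i => hpr.mfderiv_horizontalLift hA p (w i))

theorem covExtDeriv_smul_of_eq_zero [IsManifold (𝓡 (n + d)) ∞ P]
    (hpr : IsPrincipalBundle n d G pr) (hA : IsConnectionForm A) {k : ℕ}
    {α : AdForm n d G pr k} {p : P} {f : Y → ℝ}
    (hf : MDifferentiableAt (𝓡 n) 𝓘(ℝ, ℝ) f (pr p)) (hp : f (pr p) = 0)
    (hα : ContinuousAt (chartForm (pullbackForm pr α) p) (extChartAt (𝓡 (n + d)) p p)) :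
    covExtDeriv pr A (fun q => f (pr q) • α q) p =
      covectorWedge (mvfderiv (𝓡 n) f (pr p)) (α p) := by
  have h_pullback : pullbackForm pr (fun q => f (pr q) • α q) =
      fun q => (f ∘ pr) q • pullbackForm pr α q := rfl
  have h_comp : (mvfderiv (𝓡 (n + d)) (f ∘ pr) p).comp (horizontalLift pr A p) =
      mvfderiv (𝓡 n) f (pr p) := by
    ext w
    have h := DFunLike.congr_fun (mfderiv_comp p hf (hpr.mdifferentiableAt_proj p))
      (horizontalLift pr A p w)
    exact h.trans (congrArg (mfderiv (𝓡 n) 𝓘(ℝ, ℝ) f (pr p)) (hpr.mfderiv_horizontalLift hA p w))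
  rw [covExtDeriv, h_pullback,
    mExtDeriv_smul_of_eq_zero (hf.comp p (hpr.mdifferentiableAt_proj p)) hp hα,
    covectorWedge_compContinuousLinearMap, h_comp,
    hpr.pullbackForm_compContinuousLinearMap_horizontalLift hA]

theorem continuousAt_time [IsManifold (𝓡 (n + d)) ∞ P] (hpr : IsPrincipalBundle n d G pr)
    (hA : IsConnectionForm A) {k : ℕ} {I : Set ℝ} (hI : IsOpen I) {α : ℝ → AdForm n d G pr k}
    (hα : IsSmoothAdPath pr I α) {s : ℝ} (hs : s ∈ I) (p : P) :
    ContinuousAt (fun t => α t p) s := by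
  have h := hα.smooth.continuousAt_time hI hs p
  simp only [chartForm_self] at h
  have h' := (ContinuousAlternatingMap.compContinuousLinearMapCLM
    (horizontalLift pr A p)).continuous.continuousAt.comp h
  refine h'.congr (Filter.Eventually.of_forall fun t => ?_)
  exact hpr.pullbackForm_compContinuousLinearMap_horizontalLift hA (α t) p

end IsPrincipalBundle

end PrincipalBundles

section ContinuityOfHodgeStar

open Filter Topology

theorem isContinuousRiemannianBundle_tangentSpace {n : ℕ} (Y : Type*) [TopologicalSpace Y]
    [ChartedSpace (EuclideanSpace ℝ (Fin n)) Y] [IsManifold (𝓡 n) ∞ Y]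
    [RiemannianBundle (fun y : Y => TangentSpace (𝓡 n) y)]
    [IsContMDiffRiemannianBundle (𝓡 n) ∞ (EuclideanSpace ℝ (Fin n))
      (fun y : Y => TangentSpace (𝓡 n) y)] :
    IsContinuousRiemannianBundle (EuclideanSpace ℝ (Fin n))
      (fun y : Y => TangentSpace (𝓡 n) y) := by
  obtain ⟨g, hg, h⟩ := IsContMDiffRiemannianBundle.exists_contMDiff (IB := 𝓡 n) (n := ∞)
    (F := EuclideanSpace ℝ (Fin n)) (E := fun y : Y => TangentSpace (𝓡 n) y)
  exact ⟨g, hg.continuous, h⟩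

theorem trivializationAt_snd_eq_mfderiv_extChartAt {m : ℕ} {M : Type*} [TopologicalSpace M]
    [ChartedSpace (EuclideanSpace ℝ (Fin m)) M] [IsManifold (𝓡 m) ∞ M] {x z : M}
    (hz : z ∈ (chartAt (EuclideanSpace ℝ (Fin m)) x).source) (v : TangentSpace (𝓡 m) z) :
    (trivializationAt (EuclideanSpace ℝ (Fin m)) (TangentSpace (𝓡 m)) x ⟨z, v⟩).2 =
      mfderiv (𝓡 m) (𝓡 m) (extChartAt (𝓡 m) x) z v := by
  have h_mem :
      z ∈ (trivializationAt (EuclideanSpace ℝ (Fin m)) (TangentSpace (𝓡 m)) x).baseSet := by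
    simpa using hz
  refine Eq.trans ?_ (DFunLike.congr_fun (TangentBundle.continuousLinearMapAt_trivializationAt
    (I := 𝓡 m) hz) v)
  exact ((trivializationAt (EuclideanSpace ℝ (Fin m)) (TangentSpace (𝓡 m))
    x).coe_linearMapAt_of_mem (R := ℝ) h_mem ▸ rfl)

theorem apply_eq_chartForm_trivializationAt {m k : ℕ} {M : Type*} [TopologicalSpace M]
    [ChartedSpace (EuclideanSpace ℝ (Fin m)) M] [IsManifold (𝓡 m) ∞ M]
    {F : Type*} [NormedAddCommGroup F] [NormedSpace ℝ F] (β : MForm m M F k) {x z : M}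
    (hz : z ∈ (chartAt (EuclideanSpace ℝ (Fin m)) x).source) (v : Fin k → TangentSpace (𝓡 m) z) :
    β z v = chartForm β x (extChartAt (𝓡 m) x z) fun i =>
      (trivializationAt (EuclideanSpace ℝ (Fin m)) (TangentSpace (𝓡 m)) x ⟨z, v i⟩).2 := by
  have hz' : z ∈ (extChartAt (𝓡 m) x).source := by rwa [extChartAt_source]
  have key : ∀ q : M, q = z → ∀ w : Fin k → EuclideanSpace ℝ (Fin m), β q w = β z w := by
    rintro q rfl w
    rfl
  have h_comp := mfderivWithin_extChartAt_symm_comp_mfderiv_extChartAt' (I := 𝓡 m) hz'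
  rw [ModelWithCorners.range_eq_univ, mfderivWithin_univ] at h_comp
  simp only [trivializationAt_snd_eq_mfderiv_extChartAt hz]
  refine Eq.trans (congrArg (β z) (funext fun i => ?_))
    (key _ ((extChartAt (𝓡 m) x).left_inv hz') _).symm
  exact (DFunLike.congr_fun h_comp (v i)).symm

theorem SmoothForm.continuousAt_apply {m k : ℕ} {M : Type*} [TopologicalSpace M]
    [ChartedSpace (EuclideanSpace ℝ (Fin m)) M] [IsManifold (𝓡 m) ∞ M]
    {F : Type*} [NormedAddCommGroup F] [NormedSpace ℝ F] {β : MForm m M F k} (hβ : SmoothForm β)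
    {X : Type*} [TopologicalSpace X] {b : X → M} {x : X}
    (hb : ContinuousAt b x) {v : Fin k → ∀ x, TangentSpace (𝓡 m) (b x)}
    (hv : ∀ i, ContinuousAt (fun x => (⟨b x, v i x⟩ : TangentBundle (𝓡 m) M)) x) :
    ContinuousAt (fun x => β (b x) (fun i => v i x)) x := by
  have h_form : ContinuousAt (fun z => chartForm β (b x) (extChartAt (𝓡 m) (b x) (b z))) x :=
    ContinuousAt.comp (g := chartForm β (b x))
      ((hβ (b x)).continuousOn.continuousAt (extChartAt_target_mem_nhds _))
      ((continuousAt_extChartAt (I := 𝓡 m) (b x)).comp hb)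
  refine (h_form.eval (continuousAt_pi.2 fun i =>
    ((FiberBundle.continuousAt_totalSpace (EuclideanSpace ℝ (Fin m)) _).1 (hv i)).2)).congr ?_
  filter_upwards [hb ((chartAt (EuclideanSpace ℝ (Fin m)) (b x)).open_source.mem_nhds
    (mem_chart_source _ _))] with z hz
  exact (apply_eq_chartForm_trivializationAt β hz _).symm

section ChartPush

variable {m n : ℕ} {M Y : Type*} [TopologicalSpace M] [ChartedSpace (EuclideanSpace ℝ (Fin m)) M]
  [TopologicalSpace Y] [ChartedSpace (EuclideanSpace ℝ (Fin n)) Y]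

/-- The derivative of `pr` applied to the constant vector field `c` of the chart of `M` at `x`, as a
vector field along `pr`, parametrized by that chart. -/
def chartPush (pr : M → Y) (x : M) (c u : EuclideanSpace ℝ (Fin m)) :
    TangentSpace (𝓡 n) (pr ((extChartAt (𝓡 m) x).symm u)) :=
  mfderiv (𝓡 m) (𝓡 n) pr ((extChartAt (𝓡 m) x).symm u)
    (mfderiv (𝓡 m) (𝓡 m) (extChartAt (𝓡 m) x).symm u c)

variable [IsManifold (𝓡 m) ∞ M]

theorem chartPush_eq_mfderiv_comp {pr : M → Y} (hpr : ContMDiff (𝓡 m) (𝓡 n) ∞ pr) (x : M)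
    {u : EuclideanSpace ℝ (Fin m)} (hu : u ∈ (extChartAt (𝓡 m) x).target)
    (c : EuclideanSpace ℝ (Fin m)) :
    chartPush pr x c u = mfderiv (𝓡 m) (𝓡 n) (pr ∘ (extChartAt (𝓡 m) x).symm) u c := by
  have hsymm : MDifferentiableAt (𝓡 m) (𝓡 m) (extChartAt (𝓡 m) x).symm u :=
    ((contMDiffOn_extChartAt_symm x).contMDiffAt
      ((isOpen_extChartAt_target (I := 𝓡 m) x).mem_nhds hu)).mdifferentiableAt (n := ∞) (by simp)
  rw [mfderiv_comp u ((hpr _).mdifferentiableAt (by simp)) hsymm]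
  rfl

theorem chartPush_self (pr : M → Y) (x : M) (c : EuclideanSpace ℝ (Fin m)) :
    (chartPush pr x c (extChartAt (𝓡 m) x x) : EuclideanSpace ℝ (Fin n)) =
      mfderiv (𝓡 m) (𝓡 n) pr x c := by
  have h_point : (mfderiv (𝓡 m) (𝓡 n) pr ((extChartAt (𝓡 m) x).symm (extChartAt (𝓡 m) x x)) :
      EuclideanSpace ℝ (Fin m) →L[ℝ] EuclideanSpace ℝ (Fin n)) = mfderiv (𝓡 m) (𝓡 n) pr x :=
    mfderiv_congr_point (extChartAt_to_inv (I := 𝓡 m) x)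
  exact (DFunLike.congr_fun h_point _).trans (congrArg (mfderiv (𝓡 m) (𝓡 n) pr x)
    (DFunLike.congr_fun (mfderiv_extChartAt_symm_self x) c))

theorem continuousAt_chartPush [IsManifold (𝓡 n) ∞ Y] {pr : M → Y}
    (hpr : ContMDiff (𝓡 m) (𝓡 n) ∞ pr) (x : M) (c : EuclideanSpace ℝ (Fin m)) :
    ContinuousAt (fun u => (⟨pr ((extChartAt (𝓡 m) x).symm u), chartPush pr x c u⟩ :
      TangentBundle (𝓡 n) Y)) (extChartAt (𝓡 m) x x) := by
  have ho := isOpen_extChartAt_target (I := 𝓡 m) x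
  have h_tangentMap : ContinuousOn (tangentMapWithin (𝓡 m) (𝓡 n) (pr ∘ (extChartAt (𝓡 m) x).symm)
      (extChartAt (𝓡 m) x).target) _ :=
    (hpr.comp_contMDiffOn (contMDiffOn_extChartAt_symm x)).continuousOn_tangentMapWithin
      (by simp) ho.uniqueMDiffOn
  have h_const : Continuous (fun u : EuclideanSpace ℝ (Fin m) =>
      (⟨u, c⟩ : TangentBundle (𝓡 m) (EuclideanSpace ℝ (Fin m)))) :=
    (tangentBundleModelSpaceHomeomorph (𝓡 m)).symm.continuous.comp
      (continuous_id.prodMk continuous_const)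
  refine ((h_tangentMap.comp h_const.continuousOn (s := (extChartAt (𝓡 m) x).target)
    fun u hu => hu).continuousAt (extChartAt_target_mem_nhds x)).congr ?_
  filter_upwards [extChartAt_target_mem_nhds (I := 𝓡 m) x] with u hu
  rw [chartPush_eq_mfderiv_comp hpr x hu]
  exact congrArg (fun L : EuclideanSpace ℝ (Fin m) →L[ℝ] EuclideanSpace ℝ (Fin n) =>
    (⟨pr ((extChartAt (𝓡 m) x).symm u), L c⟩ : TangentBundle (𝓡 n) Y))
    (mfderivWithin_of_isOpen ho hu)

end ChartPush

section AdStar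

theorem comp_append {m n : ℕ} {α β : Type*} (f : α → β) (a : Fin m → α) (b : Fin n → α) :
    f ∘ Fin.append a b = Fin.append (f ∘ a) (f ∘ b) := by
  ext i
  refine Fin.addCases (fun j => ?_) (fun j => ?_) i <;> simp

variable {n d l : ℕ}
  {Y : Type*} [TopologicalSpace Y] [ChartedSpace (EuclideanSpace ℝ (Fin n)) Y]
  {G : Type*} [TopologicalSpace G] [ChartedSpace (EuclideanSpace ℝ (Fin d)) G] [Group G]
  {P : Type*} [TopologicalSpace P] [ChartedSpace (EuclideanSpace ℝ (Fin (n + d))) P]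
  [IsManifold (𝓡 (n + d)) ∞ P]
  [MulAction Gᵐᵒᵖ P] {pr : P → Y}

namespace IsPrincipalBundle

theorem exists_linearIndependent_chartPush (hpr : IsPrincipalBundle n d G pr) (p : P) :
    ∃ c : Fin n → EuclideanSpace ℝ (Fin (n + d)), LinearIndependent ℝ
      fun i => (chartPush pr p (c i) (extChartAt (𝓡 (n + d)) p p) :
        TangentSpace (𝓡 n) (pr _)) := by
  choose c hc using fun i => hpr.surjective_mfderiv p (EuclideanSpace.basisFun (Fin n) ℝ i)
  refine ⟨c, ?_⟩
  have h : (fun i => (chartPush pr p (c i) (extChartAt (𝓡 (n + d)) p p) :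
      EuclideanSpace ℝ (Fin n))) = EuclideanSpace.basisFun (Fin n) ℝ :=
    funext fun i => (chartPush_self pr p (c i)).trans (hc i)
  exact h.symm ▸ (EuclideanSpace.basisFun (Fin n) ℝ).orthonormal.linearIndependent

variable [IsManifold (𝓡 n) ∞ Y] [RiemannianBundle (fun y : Y => TangentSpace (𝓡 n) y)]

theorem continuousAt_volForm_chartPush (hpr : IsPrincipalBundle n d G pr)
    {o : ∀ y : Y, Orientation ℝ (TangentSpace (𝓡 n) y) (Fin n)} (ho : IsManifoldOrientation o)
    (h : 1 + l = n) (p : P) (c : EuclideanSpace ℝ (Fin (n + d)))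
    (w : Fin l → EuclideanSpace ℝ (Fin (n + d))) :
    ContinuousAt (fun u => volForm (o (pr ((extChartAt (𝓡 (n + d)) p).symm u))) fun a =>
        Fin.append (fun _ : Fin 1 => chartPush pr p c u) (fun i => chartPush pr p (w i) u)
          (Fin.cast h.symm a)) (extChartAt (𝓡 (n + d)) p p) := by
  have h_push := continuousAt_chartPush hpr.contMDiff_proj p
  have h_proj := ((FiberBundle.continuousAt_totalSpace (EuclideanSpace ℝ (Fin n)) _).1
    (h_push 0)).1
  refine (SmoothForm.continuousAt_apply ho h_proj (v := fun a u => chartPush pr p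
    (Fin.append (fun _ : Fin 1 => c) w (Fin.cast h.symm a)) u) fun a => h_push _).congr
    (Eventually.of_forall fun u => congrArg (volForm _) (funext fun a => ?_))
  exact congrFun (comp_append (chartPush pr p · u) (fun _ : Fin 1 => c) w) (Fin.cast h.symm a)

variable [IsContMDiffRiemannianBundle (𝓡 n) ∞ (EuclideanSpace ℝ (Fin n))
  (fun y : Y => TangentSpace (𝓡 n) y)]

open Matrix in
theorem continuousAt_gram_chartPush (hpr : IsPrincipalBundle n d G pr) (p : P)
    (c : Fin n → EuclideanSpace ℝ (Fin (n + d))) :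
    ContinuousAt (fun u => gram ℝ fun i =>
        (chartPush pr p (c i) u : TangentSpace (𝓡 n) (pr ((extChartAt (𝓡 (n + d)) p).symm u))))
      (extChartAt (𝓡 (n + d)) p p) := by
  have := isContinuousRiemannianBundle_tangentSpace (n := n) Y
  have h_push := continuousAt_chartPush hpr.contMDiff_proj p
  exact continuousAt_pi.2 fun i => continuousAt_pi.2 fun j =>
    ContinuousAt.inner_bundle (F := EuclideanSpace ℝ (Fin n))
      (E := fun y : Y => TangentSpace (𝓡 n) y) (h_push (c i)) (h_push (c j))

open Matrix in
theorem continuousAt_chartForm_adStar (hpr : IsPrincipalBundle n d G pr)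
    {o : ∀ y : Y, Orientation ℝ (TangentSpace (𝓡 n) y) (Fin n)} (ho : IsManifoldOrientation o)
    (h : 1 + l = n) {α : AdForm n d G pr 1} {p : P}
    (hα : ContinuousAt (chartForm (pullbackForm pr α) p) (extChartAt (𝓡 (n + d)) p p)) :
    ContinuousAt (chartForm (pullbackForm pr (adStar pr o h α)) p)
      (extChartAt (𝓡 (n + d)) p p) := by
  obtain ⟨c, hc⟩ := hpr.exists_linearIndependent_chartPush p
  have h_gram := hpr.continuousAt_gram_chartPush p c
  have h_det : ContinuousAt (fun u => (gram ℝ fun i =>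
      (chartPush pr p (c i) u : TangentSpace (𝓡 n) (pr ((extChartAt (𝓡 (n + d)) p).symm u)))).det)
      (extChartAt (𝓡 (n + d)) p p) :=
    (continuous_id.matrix_det).continuousAt.comp h_gram
  have h_det_ne := det_gram_ne_zero_iff_linearIndependent.2 hc
  have h_inv : ContinuousAt (fun u => (gram ℝ fun i =>
      (chartPush pr p (c i) u : TangentSpace (𝓡 n) (pr ((extChartAt (𝓡 (n + d)) p).symm u))))⁻¹)
      (extChartAt (𝓡 (n + d)) p p) :=
    (continuousAt_matrix_inv _ (NormedRing.inverse_continuousAt (Units.mk0 _ h_det_ne))).comp_of_eq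
      h_gram rfl
  refine continuousAt_continuousAlternatingMap fun w => ?_
  have h_vol (i : Fin n) := hpr.continuousAt_volForm_chartPush ho h p (c i) w
  have h_eval (j : Fin n) := hα.eval (continuousAt_const (y := fun _ => c j))
  have h_sum := tendsto_finsetSum Finset.univ fun j _ =>
    (continuousAt_pi.1 ((continuous_fst.matrix_mulVec continuous_snd).continuousAt.comp
      (h_inv.prodMk (continuousAt_pi.2 h_vol))) j).smul (h_eval j)
  refine ContinuousAt.congr h_sum ?_
  filter_upwards [h_det.eventually_ne h_det_ne] with u hu
  exact (hodgeStar_one_apply_eq_sum _ h hu _ _).symm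

end IsPrincipalBundle

end AdStar

end ContinuityOfHodgeStar

section AdjointRepresentation

variable {d : ℕ} {G : Type*} [TopologicalSpace G] [ChartedSpace (EuclideanSpace ℝ (Fin d)) G]
  [Group G]

theorem Ad_one : Ad (1 : G) = ContinuousLinearMap.id ℝ (GroupLieAlgebra (𝓡 d) G) := by
  ext X
  have h_conj : (fun x : G => 1 * x * 1⁻¹) = id := by
    funext x
    simp
  change mfderiv (𝓡 d) (𝓡 d) (fun x : G => 1 * x * 1⁻¹) 1 X = X
  rw [h_conj, mfderiv_id]
  rfl

variable [LieGroup (𝓡 d) ∞ G]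

theorem contMDiff_prod_conj :
    ContMDiff ((𝓡 d).prod (𝓡 d)) (𝓡 d) ∞ (fun q : G × G => q.1 * q.2 * q.1⁻¹) :=
  ((contMDiff_mul (𝓡 d) ∞).comp (contMDiff_fst.prodMk contMDiff_snd)).mul
    ((contMDiff_inv (𝓡 d) ∞).comp contMDiff_fst)

theorem mdifferentiableAt_conj (h x : G) :
    MDifferentiableAt (𝓡 d) (𝓡 d) (fun x : G => h * x * h⁻¹) x :=
  (contMDiff_prod_conj.comp (contMDiff_const.prodMk contMDiff_id) x).mdifferentiableAt
    (n := ∞) (by simp)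

theorem Ad_mul (h k : G) (X : GroupLieAlgebra (𝓡 d) G) : Ad (h * k) X = Ad h (Ad k X) := by
  have h_conj : (fun x : G => (h * k) * x * (h * k)⁻¹) =
      (fun x : G => h * x * h⁻¹) ∘ fun x : G => k * x * k⁻¹ := by
    funext x
    simp [mul_assoc]
  have h_point : (mfderiv (𝓡 d) (𝓡 d) (fun x : G => h * x * h⁻¹) (k * 1 * k⁻¹) :
      EuclideanSpace ℝ (Fin d) →L[ℝ] EuclideanSpace ℝ (Fin d)) =
        mfderiv (𝓡 d) (𝓡 d) (fun x : G => h * x * h⁻¹) 1 :=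
    mfderiv_congr_point (by simp)
  change mfderiv (𝓡 d) (𝓡 d) (fun x : G => (h * k) * x * (h * k)⁻¹) 1 X = _
  rw [h_conj, mfderiv_comp (1 : G) (mdifferentiableAt_conj h _) (mdifferentiableAt_conj k 1)]
  exact DFunLike.congr_fun h_point _

theorem tangentMap_prod_conj (g : G) (X : GroupLieAlgebra (𝓡 d) G) :
    tangentMap ((𝓡 d).prod (𝓡 d)) (𝓡 d) (fun q : G × G => q.1 * q.2 * q.1⁻¹)
        ((equivTangentBundleProd (𝓡 d) G (𝓡 d) G).symm
          ((⟨g, 0⟩ : TangentBundle (𝓡 d) G), (⟨1, X⟩ : TangentBundle (𝓡 d) G))) =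
      (⟨1, Ad g X⟩ : TangentBundle (𝓡 d) G) := by
  have h_base : ∀ q : G, q = 1 → ∀ w : EuclideanSpace ℝ (Fin d),
      (⟨q, w⟩ : TangentBundle (𝓡 d) G) = ⟨1, w⟩ := by
    rintro q rfl w
    rfl
  refine (h_base _ (by simp [equivTangentBundleProd]) _).trans ?_
  congr 1
  have h_partial := mfderiv_prod_eq_add_apply (p := (g, (1 : G))) (v := ((0, X) :
    EuclideanSpace ℝ (Fin d) × EuclideanSpace ℝ (Fin d)))
    ((contMDiff_prod_conj (g, 1)).mdifferentiableAt (by simp))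
  exact h_partial.trans ((congrArg₂ (fun a b : EuclideanSpace ℝ (Fin d) => a + b)
    (map_zero (mfderiv (𝓡 d) (𝓡 d) (fun z : G => z * 1 * z⁻¹) g)) rfl).trans (zero_add _))

theorem contMDiff_Ad (X : GroupLieAlgebra (𝓡 d) G) :
    ContMDiff (𝓡 d) 𝓘(ℝ, GroupLieAlgebra (𝓡 d) G) ∞ (fun g : G => Ad g X) := by
  have hG : IsManifold (𝓡 d) ∞ G := ContMDiffMul.toIsManifold
  have h_section : ContMDiff (𝓡 d) (𝓡 d).tangent ∞ (fun g : G =>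
      tangentMap ((𝓡 d).prod (𝓡 d)) (𝓡 d) (fun q : G × G => q.1 * q.2 * q.1⁻¹)
        ((equivTangentBundleProd (𝓡 d) G (𝓡 d) G).symm
          ((⟨g, 0⟩ : TangentBundle (𝓡 d) G), (⟨1, X⟩ : TangentBundle (𝓡 d) G)))) :=
    (contMDiff_prod_conj.contMDiff_tangentMap (m := ∞) (by simp)).comp
      (contMDiff_equivTangentBundleProd_symm.comp
        ((contMDiff_zeroSection ℝ (TangentSpace (𝓡 d))).prodMk contMDiff_const))
  simp only [tangentMap_prod_conj] at h_section
  intro g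
  refine (contMDiffAt_totalSpace.1 (h_section g)).2.congr_of_eventuallyEq
    (Filter.Eventually.of_forall fun k => ?_)
  refine Eq.trans ?_ (trivializationAt_snd_eq_mfderiv_extChartAt (mem_chart_source _ _) _).symm
  exact (DFunLike.congr_fun (mfderiv_extChartAt_self (I := 𝓡 d) (x := (1 : G))) (Ad k X)).symm

end AdjointRepresentation

section Extension

open Filter Topology

theorem exists_contMDiff_mfderiv_eq_id {n : ℕ} {Y : Type*} [TopologicalSpace Y]
    [ChartedSpace (EuclideanSpace ℝ (Fin n)) Y] [IsManifold (𝓡 n) ∞ Y] [T2Space Y] (y : Y) :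
    ∃ H : Y → EuclideanSpace ℝ (Fin n), ContMDiff (𝓡 n) (𝓡 n) ∞ H ∧ H y = 0 ∧
      (mfderiv (𝓡 n) (𝓡 n) H y : EuclideanSpace ℝ (Fin n) →L[ℝ] EuclideanSpace ℝ (Fin n)) =
        ContinuousLinearMap.id ℝ _ := by
  let χ : SmoothBumpFunction (𝓡 n) y := Classical.arbitrary _
  let ψ := extChartAt (𝓡 n) y
  have h_smooth : ContMDiffOn (𝓡 n) (𝓡 n) ∞ (fun z => ψ z - ψ y) (chartAt _ y).source :=
    (contMDiffOn_extChartAt (I := 𝓡 n) (n := ∞) (x := y)).sub contMDiffOn_const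
  have h_near : (fun z => χ z • (ψ z - ψ y)) =ᶠ[𝓝 y] (fun u => u - ψ y) ∘ ψ := by
    filter_upwards [χ.eventuallyEq_one] with z hz
    simp [hz]
  have h_chart : MDifferentiableAt (𝓡 n) (𝓡 n) ψ y :=
    mdifferentiableAt_extChartAt (mem_chart_source _ _)
  have h_sub : HasMFDerivAt (𝓡 n) (𝓡 n) (fun u : EuclideanSpace ℝ (Fin n) => u - ψ y) (ψ y)
      (ContinuousLinearMap.id ℝ (EuclideanSpace ℝ (Fin n))) :=
    ((hasFDerivAt_id (𝕜 := ℝ) (ψ y)).sub_const (ψ y)).hasMFDerivAt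
  refine ⟨fun z => χ z • (ψ z - ψ y), χ.contMDiff_smul h_smooth, by simp, ?_⟩
  refine ((h_sub.comp y h_chart.hasMFDerivAt).congr_of_eventuallyEq h_near).mfderiv.trans ?_
  exact mfderiv_extChartAt_self (I := 𝓡 n) (x := y)

variable {n d : ℕ}
  {Y : Type*} [TopologicalSpace Y] [ChartedSpace (EuclideanSpace ℝ (Fin n)) Y]
  {G : Type*} [TopologicalSpace G] [ChartedSpace (EuclideanSpace ℝ (Fin d)) G] [Group G]
  {P : Type*} [TopologicalSpace P] [ChartedSpace (EuclideanSpace ℝ (Fin (n + d))) P]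
  [MulAction Gᵐᵒᵖ P] {pr : P → Y}

theorem IsPrincipalBundle.exists_equivariantEndomorphism [LieGroup (𝓡 d) ∞ G]
    (hpr : IsPrincipalBundle n d G pr) [IsManifold (𝓡 n) ∞ Y] [T2Space Y] (p : P) :
    ∃ L : P → GroupLieAlgebra (𝓡 d) G →L[ℝ] GroupLieAlgebra (𝓡 d) G,
      (∀ X, ContMDiff (𝓡 (n + d)) 𝓘(ℝ, GroupLieAlgebra (𝓡 d) G) ∞ fun q => L q X) ∧
      L p = ContinuousLinearMap.id ℝ _ ∧
      ∀ (q : P) (g : G) (X), L (MulOpposite.op g • q) X = Ad g⁻¹ (L q X) := by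
  obtain ⟨U, Φ, hU, hy, hs, -, hΦ⟩ := hpr.locally_trivial (pr p)
  obtain ⟨χ, -, hχ⟩ := (SmoothBumpFunction.nhds_basis_tsupport (I := 𝓡 n) (pr p)).mem_iff.1
    (hU.mem_nhds hy)
  have h_source {q : P} (hq : pr q ∈ tsupport χ) : q ∈ Φ.source := hs ▸ hχ hq
  refine ⟨fun q => χ (pr q) • (Ad (Φ q).2⁻¹).comp (Ad (Φ p).2), fun X => ?_, ?_, fun q g X => ?_⟩
  · refine contMDiff_of_tsupport fun q hq => ?_
    have hq : pr q ∈ tsupport χ := tsupport_comp_subset_preimage _ hpr.contMDiff_proj.continuous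
      (tsupport_smul_subset_left (χ ∘ pr) _ hq)
    have h_inv : ContMDiffAt (𝓡 (n + d)) (𝓡 d) ∞ (fun q => (Φ q).2⁻¹) q :=
      ((contMDiff_inv (𝓡 d) ∞).comp contMDiff_snd).contMDiffAt.comp q
        (Φ.contMDiffOn.contMDiffAt (Φ.open_source.mem_nhds (h_source hq)))
    exact (χ.contMDiff.comp hpr.contMDiff_proj).contMDiffAt.smul
      ((contMDiff_Ad (Ad (Φ p).2 X)).contMDiffAt.comp q h_inv)
  · ext X
    simp [← Ad_mul, Ad_one]
  · by_cases hq : pr q ∈ tsupport χ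
    · simp [hpr.proj_act, (hΦ q (h_source hq)).2 g, Ad_mul]
    · simp [hpr.proj_act, image_eq_zero_of_notMem_tsupport hq]

/-- The `𝔤`-valued form `(L q) (H^* β)` along `pr`, for an alternating map `β` on `ℝⁿ`. It serves to
extend the value of an `ad P`-valued form at a point to a global form. -/
def pullbackTwist {k : ℕ} (pr : P → Y) (H : Y → EuclideanSpace ℝ (Fin n))
    (L : P → GroupLieAlgebra (𝓡 d) G →L[ℝ] GroupLieAlgebra (𝓡 d) G)
    (β : EuclideanSpace ℝ (Fin n) [⋀^Fin k]→L[ℝ] GroupLieAlgebra (𝓡 d) G) :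
    AdForm n d G pr k := fun q =>
  (L q).compContinuousAlternatingMap (β.compContinuousLinearMap
    (mfderiv (𝓡 n) (𝓡 n) H (pr q) : TangentSpace (𝓡 n) (pr q) →L[ℝ] EuclideanSpace ℝ (Fin n)))

variable {k : ℕ} {H : Y → EuclideanSpace ℝ (Fin n)}
  {L : P → GroupLieAlgebra (𝓡 d) G →L[ℝ] GroupLieAlgebra (𝓡 d) G}

omit [MulAction Gᵐᵒᵖ P] in
theorem pullbackForm_pullbackTwist (hH : ContMDiff (𝓡 n) (𝓡 n) ∞ H)
    (hpr : ContMDiff (𝓡 (n + d)) (𝓡 n) ∞ pr)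
    (β : EuclideanSpace ℝ (Fin n) [⋀^Fin k]→L[ℝ] GroupLieAlgebra (𝓡 d) G)
    (q : P) (w : Fin k → TangentSpace (𝓡 (n + d)) q) :
    pullbackForm pr (pullbackTwist pr H L β) q w =
      L q (β fun i => mfderiv (𝓡 (n + d)) (𝓡 n) (H ∘ pr) q (w i)) := by
  rw [mfderiv_comp q ((hH _).mdifferentiableAt (by simp)) ((hpr q).mdifferentiableAt (by simp))]
  rfl

omit [MulAction Gᵐᵒᵖ P] in
theorem smoothForm_pullbackForm_pullbackTwist [IsManifold (𝓡 (n + d)) ∞ P]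
    (hH : ContMDiff (𝓡 n) (𝓡 n) ∞ H) (hpr : ContMDiff (𝓡 (n + d)) (𝓡 n) ∞ pr)
    (hL : ∀ X, ContMDiff (𝓡 (n + d)) 𝓘(ℝ, GroupLieAlgebra (𝓡 d) G) ∞ fun q => L q X)
    (β : EuclideanSpace ℝ (Fin n) [⋀^Fin k]→L[ℝ] GroupLieAlgebra (𝓡 d) G) :
    SmoothForm (pullbackForm pr (pullbackTwist pr H L β)) := by
  intro p
  let ψ := extChartAt (𝓡 (n + d)) p
  have ho : IsOpen ψ.target := isOpen_extChartAt_target p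
  have h_symm : ContMDiffOn (𝓡 (n + d)) (𝓡 (n + d)) ∞ ψ.symm ψ.target :=
    contMDiffOn_extChartAt_symm p
  have h_fderiv : ContDiffOn ℝ ∞ (fderiv ℝ ((H ∘ pr) ∘ ψ.symm)) ψ.target :=
    (contMDiffOn_iff_contDiffOn.1 ((hH.comp hpr).comp_contMDiffOn h_symm)).fderiv_of_isOpen ho
      (by simp)
  have h_twist : ContDiffOn ℝ ∞ (L ∘ ψ.symm) ψ.target := contDiffOn_clm_apply.2 fun X =>
    contMDiffOn_iff_contDiffOn.1 ((hL X).comp_contMDiffOn h_symm)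
  refine contDiffOn_continuousAlternatingMap fun w => ?_
  refine (h_twist.clm_apply (β.toContinuousMultilinearMap.contDiff.comp_contDiffOn
    (contDiffOn_pi.2 fun i => h_fderiv.clm_apply (contDiffOn_const (c := w i))))).congr
      fun u hu => ?_
  refine (pullbackForm_pullbackTwist hH hpr β (ψ.symm u) _).trans ?_
  refine congrArg (fun v => L (ψ.symm u) (β v)) (funext fun i => ?_)
  have h_comp := mfderiv_comp u (((hH.comp hpr) (ψ.symm u)).mdifferentiableAt (by simp))
    ((h_symm.contMDiffAt (ho.mem_nhds hu)).mdifferentiableAt (by simp))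
  rw [mfderiv_eq_fderiv] at h_comp
  exact (DFunLike.congr_fun h_comp (w i)).symm

namespace IsPrincipalBundle

theorem isAdForm_pullbackTwist (hpr : IsPrincipalBundle n d G pr)
    (hH : ContMDiff (𝓡 n) (𝓡 n) ∞ H)
    (hL : ∀ (q : P) (g : G) (X), L (MulOpposite.op g • q) X = Ad g⁻¹ (L q X))
    (β : EuclideanSpace ℝ (Fin n) [⋀^Fin k]→L[ℝ] GroupLieAlgebra (𝓡 d) G) :
    IsAdForm pr (pullbackTwist pr H L β) := by
  intro q g w
  have h_inv : (H ∘ pr) ∘ (fun z : P => MulOpposite.op g • z) = H ∘ pr :=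
    funext fun z => congrArg H (hpr.proj_act z g)
  have h_comp := mfderiv_comp q (((hH.comp hpr.contMDiff_proj)
    (MulOpposite.op g • q)).mdifferentiableAt (by simp)) (hpr.mdifferentiableAt_act g q)
  rw [h_inv] at h_comp
  rw [pullbackForm_pullbackTwist hH hpr.contMDiff_proj,
    pullbackForm_pullbackTwist hH hpr.contMDiff_proj, hL]
  exact congrArg (fun v => Ad g⁻¹ (L q (β v)))
    (funext fun i => (DFunLike.congr_fun h_comp (w i)).symm)

theorem exists_isSmoothAdPath_eq [LieGroup (𝓡 d) ∞ G] [IsManifold (𝓡 n) ∞ Y] [T2Space Y]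
    [IsManifold (𝓡 (n + d)) ∞ P] (hpr : IsPrincipalBundle n d G pr) (I : Set ℝ) (p : P)
    (β : TangentSpace (𝓡 n) (pr p) [⋀^Fin k]→L[ℝ] GroupLieAlgebra (𝓡 d) G) :
    ∃ α : AdForm n d G pr k, IsSmoothAdPath pr I (fun _ => α) ∧ α p = β := by
  obtain ⟨H, hH, -, hHp⟩ := exists_contMDiff_mfderiv_eq_id (n := n) (pr p)
  obtain ⟨L, hL, hLp, hLg⟩ := hpr.exists_equivariantEndomorphism p
  refine ⟨pullbackTwist pr H L β, ⟨fun _ _ => hpr.isAdForm_pullbackTwist hH hLg β, fun x₀ =>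
    (smoothForm_pullbackForm_pullbackTwist hH hpr.contMDiff_proj hL β x₀).comp contDiffOn_snd
      fun q hq => hq.2⟩, ?_⟩
  ext w
  change L p (β fun i => (mfderiv (𝓡 n) (𝓡 n) H (pr p) : EuclideanSpace ℝ (Fin n) →L[ℝ]
    EuclideanSpace ℝ (Fin n)) (w i)) = β w
  rw [hLp, hHp]
  rfl

end IsPrincipalBundle

end Extension

section PartialDerivatives

variable {n : ℕ} {Y : Type*} [TopologicalSpace Y] [ChartedSpace (EuclideanSpace ℝ (Fin n)) Y]

theorem mfderiv_prod_ne_zero_iff {f : ℝ × Y → ℝ} {s : ℝ} {y : Y}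
    (hf : MDifferentiableAt ((𝓘(ℝ, ℝ)).prod (𝓡 n)) 𝓘(ℝ, ℝ) f (s, y)) :
    mfderiv ((𝓘(ℝ, ℝ)).prod (𝓡 n)) 𝓘(ℝ, ℝ) f (s, y) ≠ 0 ↔
      deriv (fun t => f (t, y)) s ≠ 0 ∨ mvfderiv (𝓡 n) (fun z => f (s, z)) y ≠ 0 := by
  have h_apply (v : ℝ × EuclideanSpace ℝ (Fin n)) :
      (mfderiv ((𝓘(ℝ, ℝ)).prod (𝓡 n)) 𝓘(ℝ, ℝ) f (s, y) v : ℝ) =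
        v.1 * deriv (fun t => f (t, y)) s + mvfderiv (𝓡 n) (fun z => f (s, z)) y v.2 := by
    refine (mfderiv_prod_eq_add_apply hf).trans
      (congrArg₂ (fun a b : ℝ => a + b) ?_ rfl)
    rw [mfderiv_eq_fderiv]
    exact fderiv_eq_smul_deriv v.1
  rw [← not_and_or, not_iff_not]
  constructor
  · intro h
    have h_zero (v : ℝ × EuclideanSpace ℝ (Fin n)) :
        v.1 * deriv (fun t => f (t, y)) s + mvfderiv (𝓡 n) (fun z => f (s, z)) y v.2 = 0 :=
      (h_apply v).symm.trans (DFunLike.congr_fun h v)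
    have hξ : mvfderiv (𝓡 n) (fun z => f (s, z)) y = 0 :=
      ContinuousLinearMap.ext fun w => by simpa using h_zero (0, w)
    refine ⟨?_, hξ⟩
    calc deriv (fun t => f (t, y)) s
        = 1 * deriv (fun t => f (t, y)) s + mvfderiv (𝓡 n) (fun z => f (s, z)) y 0 := by
          rw [map_zero, one_mul, add_zero]
      _ = 0 := h_zero (1, 0)
  · rintro ⟨hτ, hξ⟩
    refine ContinuousLinearMap.ext fun v => (h_apply v).trans ?_
    rw [hτ, hξ, mul_zero]
    exact add_zero 0

theorem exists_contMDiff_deriv_eq_mvfderiv_eq [IsManifold (𝓡 n) ∞ Y] [T2Space Y] (s : ℝ) (y : Y)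
    (τ : ℝ) (ξ : TangentSpace (𝓡 n) y →L[ℝ] ℝ) :
    ∃ f : ℝ × Y → ℝ, ContMDiff ((𝓘(ℝ, ℝ)).prod (𝓡 n)) 𝓘(ℝ, ℝ) ∞ f ∧ f (s, y) = 0 ∧
      deriv (fun t => f (t, y)) s = τ ∧ mvfderiv (𝓡 n) (fun z => f (s, z)) y = ξ := by
  obtain ⟨H, hH, hHy, hH'⟩ := exists_contMDiff_mfderiv_eq_id (n := n) y
  let ξ' : EuclideanSpace ℝ (Fin n) →L[ℝ] ℝ := ξ
  have h_time : ContDiff ℝ ∞ fun t : ℝ => (t - s) * τ := by fun_prop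
  refine ⟨fun q => (q.1 - s) * τ + ξ' (H q.2), ?_, by simp [hHy], ?_, ?_⟩
  · exact (h_time.contMDiff.comp contMDiff_fst).add
      (ξ'.contDiff.contMDiff.comp (hH.comp contMDiff_snd))
  · simp [hHy]
  · have h_comp := mfderiv_comp y (ξ'.mdifferentiableAt (x := H y))
      ((hH y).mdifferentiableAt (by simp))
    rw [ContinuousLinearMap.mfderiv_eq] at h_comp
    ext w
    simp only [sub_self, zero_mul, zero_add]
    exact (DFunLike.congr_fun h_comp w).trans (congrArg ξ' (DFunLike.congr_fun hH' w))

end PartialDerivatives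

section PrincipalSymbol

theorem wedgeBracket_zero_right {d : ℕ} {G : Type*} [TopologicalSpace G]
    [ChartedSpace (EuclideanSpace ℝ (Fin d)) G] [Group G] [LieGroup (𝓡 d) ∞ G]
    {V : Type*} [AddCommGroup V] [Module ℝ V] [TopologicalSpace V] {k l m : ℕ}
    (h : k + l = m) (a : V [⋀^Fin k]→L[ℝ] GroupLieAlgebra (𝓡 d) G) :
    wedgeBracket h a (0 : V [⋀^Fin l]→L[ℝ] GroupLieAlgebra (𝓡 d) G) = 0 := by
  have h_mul : bracketMul a (0 : V [⋀^Fin l]→L[ℝ] GroupLieAlgebra (𝓡 d) G) = 0 := by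
    ext v
    exact lie_zero (a fun i => v (Fin.castAdd l i))
  ext v
  simp [wedgeBracket, h_mul, ContinuousMultilinearMap.alternatization_apply_apply]

variable {n d : ℕ}
  {Y : Type*} [TopologicalSpace Y] [ChartedSpace (EuclideanSpace ℝ (Fin n)) Y]
  {G : Type*} [TopologicalSpace G] [ChartedSpace (EuclideanSpace ℝ (Fin d)) G] [Group G]
  [LieGroup (𝓡 d) ∞ G]
  {P : Type*} [TopologicalSpace P] [ChartedSpace (EuclideanSpace ℝ (Fin (n + d))) P]
  [IsManifold (𝓡 (n + d)) ∞ P]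
  [MulAction Gᵐᵒᵖ P] {pr : P → Y}

namespace IsPrincipalBundle

theorem nablaS_smul_of_eq_zero (hpr : IsPrincipalBundle n d G pr)
    {A : ∀ p : P, TangentSpace (𝓡 (n + d)) p →L[ℝ] GroupLieAlgebra (𝓡 d) G}
    (hA : IsConnectionForm A) {I : Set ℝ} (hI : IsOpen I) {s : ℝ} (hs : s ∈ I) {p : P}
    {f : ℝ × Y → ℝ} (hf : DifferentiableAt ℝ (fun t => f (t, pr p)) s) (hp : f (s, pr p) = 0)
    (Ψ : ℝ → AdForm n d G pr 0) {k : ℕ} {α : ℝ → AdForm n d G pr k}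
    (hα : IsSmoothAdPath pr I α) :
    nablaS pr Ψ (fun t q => f (t, pr q) • α t q) s p =
      deriv (fun t => f (t, pr p)) s • α s p := by
  have h_deriv : deriv (fun t => f (t, pr p) • α t p) s =
      deriv (fun t => f (t, pr p)) s • α s p :=
    deriv_smul_of_eq_zero
      (W := EuclideanSpace ℝ (Fin n) [⋀^Fin k]→L[ℝ] GroupLieAlgebra (𝓡 d) G)
      hf.hasDerivAt hp (hpr.continuousAt_time hA hI hα hs p)
  simp only [nablaS, h_deriv, hp, zero_smul, wedgeBracket_zero_right, add_zero]

theorem exists_isSmoothTriple_eq [IsManifold (𝓡 n) ∞ Y] [T2Space Y]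
    (hpr : IsPrincipalBundle n d G pr) (I : Set ℝ) (s : ℝ) (p : P) (x : TripleFibre n d G pr p) :
    ∃ u : TripleField n d G pr, IsSmoothTriple pr I u ∧ u s p = x := by
  obtain ⟨α, hα, hαp⟩ := hpr.exists_isSmoothAdPath_eq I p x.1
  obtain ⟨v, hv, hvp⟩ := hpr.exists_isSmoothAdPath_eq I p x.2.1
  obtain ⟨ψ, hψ, hψp⟩ := hpr.exists_isSmoothAdPath_eq I p x.2.2
  exact ⟨fun _ q => (α q, v q, ψ q), ⟨hα, hv, hψ⟩, Prod.ext hαp (Prod.ext hvp hψp)⟩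

variable [IsManifold (𝓡 n) ∞ Y] [RiemannianBundle (fun y : Y => TangentSpace (𝓡 n) y)]
  [IsContMDiffRiemannianBundle (𝓡 n) ∞ (EuclideanSpace ℝ (Fin n))
    (fun y : Y => TangentSpace (𝓡 n) y)]
  {o : ∀ y : Y, Orientation ℝ (TangentSpace (𝓡 n) y) (Fin n)} {I : Set ℝ}
  {A : ℝ → ∀ p : P, TangentSpace (𝓡 (n + d)) p →L[ℝ] GroupLieAlgebra (𝓡 d) G}

theorem linearizedOperator_smul_of_eq_zero (hpr : IsPrincipalBundle n d G pr)
    (hn : 2 ≤ n) (ho : IsManifoldOrientation o)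
    (om : ℝ → AdForm n d G pr (n - 2)) (Ψ : ℝ → AdForm n d G pr 0)
    (hI : IsOpen I) {s : ℝ} (hs : s ∈ I) (hA : IsConnectionForm (A s)) {p : P}
    {f : ℝ × Y → ℝ} (hf : MDifferentiableAt ((𝓘(ℝ, ℝ)).prod (𝓡 n)) 𝓘(ℝ, ℝ) f (s, pr p))
    (hp : f (s, pr p) = 0) {u : TripleField n d G pr} (hu : IsSmoothTriple pr I u) :
    linearizedOperator hn pr o A om Ψ (fun t q => f (t, pr q) • u t q) s p =
      linearizedSymbol hn (o (pr p)) (deriv (fun t => f (t, pr p)) s)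
        (mvfderiv (𝓡 n) (fun y => f (s, y)) (pr p)) (u s p) := by
  have h_time : DifferentiableAt ℝ (fun t => f (t, pr p)) s :=
    (hf.comp s (mdifferentiableAt_id.prodMk mdifferentiableAt_const)).differentiableAt
  have h_space : MDifferentiableAt (𝓡 n) 𝓘(ℝ, ℝ) (fun y => f (s, y)) (pr p) :=
    hf.comp (pr p) (mdifferentiableAt_const.prodMk mdifferentiableAt_id)
  have h_nabla {k : ℕ} {α : ℝ → AdForm n d G pr k} (hα : IsSmoothAdPath pr I α) :=
    hpr.nablaS_smul_of_eq_zero hA hI hs h_time hp Ψ hα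
  have h_cov {k : ℕ} {α : AdForm n d G pr k} (hα : ContinuousAt (chartForm (pullbackForm pr α) p)
      (extChartAt (𝓡 (n + d)) p p)) :=
    hpr.covExtDeriv_smul_of_eq_zero hA h_space hp hα
  have hα := hu.fst.smooth.continuousAt_space hI hs p
  have h_star_zero {k l : ℕ} (h : k + l = n) :
      hodgeStar (o (pr p)) h (0 : AdFibre n d G pr k p) = 0 := map_zero (hodgeStarLinear _ h)
  have h_star_apply {k l : ℕ} (h : k + l = n) (β : AdForm n d G pr k) :
      adStar pr o h β p = hodgeStar (o (pr p)) h (β p) := rfl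
  have h_codiff : covExtDeriv pr (A s) (adStar pr o (show 1 + (n - 1) = n by omega)
      fun q => f (s, pr q) • (u s q).1) p =
        covectorWedge (mvfderiv (𝓡 n) (fun y => f (s, y)) (pr p))
          (adStar pr o (show 1 + (n - 1) = n by omega) (fun q => (u s q).1) p) := by
    rw [← h_cov (hpr.continuousAt_chartForm_adStar ho (show 1 + (n - 1) = n by omega) hα)]
    exact congrArg (covExtDeriv pr (A s) · p)
      (funext fun q => map_smul (hodgeStarLinear (o (pr q)) _) _ _)
  simp only [linearizedOperator, covCoderiv, Prod.smul_fst, Prod.smul_snd, h_nabla hu.fst,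
    h_nabla hu.snd, h_nabla hu.thd, hp, zero_smul, wedgeBracket_zero_right,
    h_star_zero, add_zero, sub_zero, Pi.neg_apply, sub_neg_eq_add]
  simp only [h_star_apply, h_codiff, h_cov hα, h_cov (hu.snd.smooth.continuousAt_space hI hs p),
    h_cov (hu.thd.smooth.continuousAt_space hI hs p)]
  rfl

theorem isElliptic_linearizedOperator_iff [T2Space Y] (hpr : IsPrincipalBundle n d G pr)
    (hn : 2 ≤ n) (ho : IsManifoldOrientation o)
    (om : ℝ → AdForm n d G pr (n - 2)) (Ψ : ℝ → AdForm n d G pr 0)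
    (hI : IsOpen I) (hA : IsSmoothConnectionPath I A) :
    IsElliptic pr I (linearizedOperator hn pr o A om Ψ) ↔
      ∀ s ∈ I, ∀ (p : P) (τ : ℝ) (ξ : TangentSpace (𝓡 n) (pr p) →L[ℝ] ℝ), (τ ≠ 0 ∨ ξ ≠ 0) →
        Function.Bijective
          (linearizedSymbol (W := GroupLieAlgebra (𝓡 d) G) hn (o (pr p)) τ ξ) := by
  constructor
  · intro h s hs p τ ξ hτξ
    obtain ⟨f, hf, hp, rfl, rfl⟩ := exists_contMDiff_deriv_eq_mvfderiv_eq s (pr p) τ ξ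
    have hf' := (hf (s, pr p)).mdifferentiableAt (n := ∞) (by simp)
    obtain ⟨σ, hσ⟩ := h s hs p f hf hp ((mfderiv_prod_ne_zero_iff hf').2 hτξ)
    convert σ.bijective using 1
    ext1 x
    obtain ⟨u, hu, rfl⟩ := hpr.exists_isSmoothTriple_eq I s p x
    rw [← hσ u hu, hpr.linearizedOperator_smul_of_eq_zero hn ho om Ψ hI hs
      (hA.isConnection s hs) hf' hp hu]
  · intro h s hs p f hf hp hne
    have hf' := (hf (s, pr p)).mdifferentiableAt (n := ∞) (by simp)
    exact ⟨LinearEquiv.ofBijective _ (h s hs p _ _ ((mfderiv_prod_ne_zero_iff hf').1 hne)),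
      fun u hu => hpr.linearizedOperator_smul_of_eq_zero hn ho om Ψ hI hs
        (hA.isConnection s hs) hf' hp hu⟩

end IsPrincipalBundle

end PrincipalSymbol

theorem proposition10p1_general {n d : ℕ} (hn : 2 ≤ n) (hd : 0 < d)
    {Y : Type*} [TopologicalSpace Y] [ChartedSpace (EuclideanSpace ℝ (Fin n)) Y]
    [IsManifold (𝓡 n) ∞ Y] [T2Space Y] [Nonempty Y]
    [RiemannianBundle (fun y : Y => TangentSpace (𝓡 n) y)]
    [IsContMDiffRiemannianBundle (𝓡 n) ∞ (EuclideanSpace ℝ (Fin n))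
      (fun y : Y => TangentSpace (𝓡 n) y)]
    {o : ∀ y : Y, Orientation ℝ (TangentSpace (𝓡 n) y) (Fin n)} (ho : IsManifoldOrientation o)
    {G : Type*} [TopologicalSpace G] [ChartedSpace (EuclideanSpace ℝ (Fin d)) G] [Group G]
    [LieGroup (𝓡 d) ∞ G]
    {P : Type*} [TopologicalSpace P] [ChartedSpace (EuclideanSpace ℝ (Fin (n + d))) P]
    [IsManifold (𝓡 (n + d)) ∞ P] [MulAction Gᵐᵒᵖ P]
    {pr : P → Y} (hpr : IsPrincipalBundle n d G pr)
    {I : Set ℝ} (hI : IsOpen I) (hI' : I.Nonempty)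
    {A : ℝ → ∀ p : P, TangentSpace (𝓡 (n + d)) p →L[ℝ] GroupLieAlgebra (𝓡 d) G}
    (hA : IsSmoothConnectionPath I A)
    (om : ℝ → AdForm n d G pr (n - 2)) (Ψ : ℝ → AdForm n d G pr 0) :
    IsElliptic pr I (linearizedOperator hn pr o A om Ψ) ↔ n = 2 := by
  rw [hpr.isElliptic_linearizedOperator_iff hn ho om Ψ hI hA]
  constructor
  · intro h
    by_contra hne
    have : Nonempty (Fin d) := ⟨⟨0, hd⟩⟩
    have : Nontrivial (GroupLieAlgebra (𝓡 d) G) :=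
      inferInstanceAs (Nontrivial (EuclideanSpace ℝ (Fin d)))
    obtain ⟨s, hs⟩ := hI'
    obtain ⟨p, -⟩ := hpr.surjective_proj (Classical.arbitrary Y)
    obtain ⟨ξ, hξ, hker⟩ := not_injective_linearizedSymbol (TangentSpace (𝓡 n) (pr p))
      (GroupLieAlgebra (𝓡 d) G) (lt_of_le_of_ne hn (Ne.symm hne))
    exact hker (o (pr p)) (h s hs p 0 ξ (Or.inr hξ)).injective
  · rintro rfl s - p τ ξ hτξ
    exact bijective_linearizedSymbol (o (pr p)) hτξ

end

/-- Let `pr : P → Y` be a principal `G`-bundle over a nonempty closed oriented Riemannian manifold of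
dimension `n ≥ 2`, where `G` is a compact Lie group of dimension `d > 0`. For every smooth path
`(A, ω, Ψ)` over a nonempty open interval `I`, the operator `∇_s + B_{(A,ω,Ψ)}` is elliptic if and
only if `n = 2`. -/
theorem proposition10p1 {n d : ℕ} (hn : 2 ≤ n) (hd : 0 < d)
    {Y : Type*} [TopologicalSpace Y] [ChartedSpace (EuclideanSpace ℝ (Fin n)) Y]
    [IsManifold (𝓡 n) ∞ Y] [T2Space Y] [CompactSpace Y] [Nonempty Y]
    [RiemannianBundle (fun y : Y => TangentSpace (𝓡 n) y)]
    [IsContMDiffRiemannianBundle (𝓡 n) ∞ (EuclideanSpace ℝ (Fin n))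
      (fun y : Y => TangentSpace (𝓡 n) y)]
    (o : ∀ y : Y, Orientation ℝ (TangentSpace (𝓡 n) y) (Fin n)) (ho : IsManifoldOrientation o)
    {G : Type*} [TopologicalSpace G] [ChartedSpace (EuclideanSpace ℝ (Fin d)) G] [Group G]
    [LieGroup (𝓡 d) ∞ G] [T2Space G] [CompactSpace G]
    {P : Type*} [TopologicalSpace P] [ChartedSpace (EuclideanSpace ℝ (Fin (n + d))) P]
    [IsManifold (𝓡 (n + d)) ∞ P] [MulAction Gᵐᵒᵖ P]
    (pr : P → Y) (hpr : IsPrincipalBundle n d G pr)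
    (I : Set ℝ) (hI : IsOpen I) (hI' : I.OrdConnected) (hI'' : I.Nonempty)
    (A : ℝ → ∀ p : P, TangentSpace (𝓡 (n + d)) p →L[ℝ] GroupLieAlgebra (𝓡 d) G)
    (hA : IsSmoothConnectionPath I A)
    (om : ℝ → AdForm n d G pr (n - 2)) (hom : IsSmoothAdPath pr I om)
    (Ψ : ℝ → AdForm n d G pr 0) (hΨ : IsSmoothAdPath pr I Ψ) :
    IsElliptic pr I (linearizedOperator hn pr o A om Ψ) ↔ n = 2 :=
  proposition10p1_general hn hd ho hpr hI hI'' hA om Ψ
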